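/- Let $I=(0,1)$, and let $\Delta:=-\frac{d^2}{dx^2}$ on $L^2(I)=L^2(I;\mathbb C)$ with domain $D(\Delta):=H^2(0,1)\cap H^1_0(0,1)$. Let $\mathbb X:=I\sqcup I$ be the disjoint union of two copies of $I$, with Lebesgue measure on each copy, and with the generalized metric $d_{\mathbb X}$ that is $|x-x'|$ for two points $x,x'$ of the same copy and $+\infty$ for two points of different copies; equip $\mathbb X\times\mathbb X$ with the sum metric. Identify $L^2(\mathbb X)$ with $L^2(I)\times L^2(I)$, and let $$\mathcal A:=\begin{pmatrix}0&\Delta\\-\Delta&-\Delta\end{pmatrix},\qquad D(\mathcal A):=D(\Delta)\times D(\Delta).$$ For a generalized metric space $(Y,d)$ and a normed space $E$, let $C^{0,1}(Y;E)$ be the set of all bounded functions $f:Y\to E$ with $\sup_{y\ne y'}\|f(y)-f(y')\|_E/d(y,y')<\infty$ (a quotient by $+\infty$ is $0$). Then $\mathcal A$ generates a strongly continuous semigroup $(e^{t\mathcal A})_{t\ge0}$ on $L^2(\mathbb X)$, and there is a family $(p_t)_{t>0}$ of functions $p_t:\mathbb X\times\mathbb X\to\mathbb C$ with the following properties. 1.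 For all $t>0$, $p_t$ is an integral kernel of $e^{t\mathcal A}$: it is measurable, and for all $f\in L^2(\mathbb X)$ and a.e. $x\in\mathbb X$ the function $p_t(x,\cdot)f$ is integrable and $(e^{t\mathcal A}f)(x)=\int_{\mathbb X}p_t(x,y)f(y)\,dy$. Moreover, $p_t$ is bounded and jointly Lipschitz continuous, i.e. $p_t\in C^{0,1}(\mathbb X\times\mathbb X;\mathbb C)$. 2. For all $t>0$ and all $x\in\mathbb X$, $p_t(x,\cdot)\in D(\mathcal A)$, and the map $x\mapsto p_t(x,\cdot)$ belongs to $C^{0,1}(\mathbb X;D(\mathcal A))$, where $D(\mathcal A)$ carries the graph norm $\|u\|_{L^2(\mathbb X)}+\|\mathcal Au\|_{L^2(\mathbb X)}$. 3. There are constants $C_1,C_2>0$ such that for all $t>0$ and all $x,x'\in\mathbb X$ $$\left\|\mathcal Ap_t(x,\cdot)-\mathcal Ap_t(x',\cdot)\right\|_{L^2(\mathbb X)}\le\left(C_1t^{-1}+C_2t^{-2}\right)d_{\mathbb X}(x,x').$$ -/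

import Mathlib

open MeasureTheory Set Filter Topology
open scoped ENNReal NNReal ContDiff

noncomputable section

namespace DampedWave

/-! ### The disjoint union of two copies of a space -/

/-- The generalized (`[0, ∞]`-valued) metric of `X ⊔ X`: the metric of `X` on each of the two
copies, and `∞` between points of different copies. -/
def sumDist {X : Type*} [EDist X] : X ⊕ X → X ⊕ X → ℝ≥0∞
  | Sum.inl x, Sum.inl y => edist x y
  | Sum.inr x, Sum.inr y => edist x y
  | Sum.inl _, Sum.inr _ => ∞
  | Sum.inr _, Sum.inl _ => ∞

/-- The sum metric on `Y × Y` that belongs to a generalized metric `d` on `Y`. -/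
def prodDist {Y : Type*} (d : Y → Y → ℝ≥0∞) (p q : Y × Y) : ℝ≥0∞ :=
  d p.1 q.1 + d p.2 q.2

/-- The measure on `X ⊔ X` that restricts to `μ` on each of the two copies of `X`. -/
def sumMeasure {X : Type*} [MeasurableSpace X] (μ : Measure X) : Measure (X ⊕ X) :=
  μ.map Sum.inl + μ.map Sum.inr

section Glue

variable {X : Type*} [MeasurableSpace X] {μ : Measure X}

theorem measurableEmbedding_inl : MeasurableEmbedding (Sum.inl : X → X ⊕ X) :=
  ⟨Sum.inl_injective, measurable_inl, fun _ hs => measurableSet_inl_image.2 hs⟩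

theorem measurableEmbedding_inr : MeasurableEmbedding (Sum.inr : X → X ⊕ X) :=
  ⟨Sum.inr_injective, measurable_inr, fun _ hs => measurableSet_inr_image.2 hs⟩

theorem ae_sumMeasure {P : X ⊕ X → Prop} :
    (∀ᵐ z ∂(sumMeasure μ), P z) ↔
      (∀ᵐ x ∂μ, P (Sum.inl x)) ∧ (∀ᵐ x ∂μ, P (Sum.inr x)) := by
  rw [sumMeasure, ae_add_measure_iff, measurableEmbedding_inl.ae_map_iff,
    measurableEmbedding_inr.ae_map_iff]

theorem memLp_comp_inl {f : X ⊕ X → ℂ} (hf : MemLp f 2 (sumMeasure μ)) :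
    MemLp (fun x => f (Sum.inl x)) 2 μ :=
  measurableEmbedding_inl.memLp_map_measure_iff.1
    (hf.mono_measure (Measure.le_add_right le_rfl))

theorem memLp_comp_inr {f : X ⊕ X → ℂ} (hf : MemLp f 2 (sumMeasure μ)) :
    MemLp (fun x => f (Sum.inr x)) 2 μ :=
  measurableEmbedding_inr.memLp_map_measure_iff.1
    (hf.mono_measure (Measure.le_add_left le_rfl))

theorem memLp_sumElim {u v : X → ℂ} (hu : MemLp u 2 μ) (hv : MemLp v 2 μ) :
    MemLp (Sum.elim u v) 2 (sumMeasure μ) := by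
  have h1 : MemLp (Sum.elim u v) 2 (μ.map Sum.inl) :=
    measurableEmbedding_inl.memLp_map_measure_iff.2 hu
  have h2 : MemLp (Sum.elim u v) 2 (μ.map Sum.inr) :=
    measurableEmbedding_inr.memLp_map_measure_iff.2 hv
  have h0 : AEStronglyMeasurable (Sum.elim u v) (sumMeasure μ) := h1.1.add_measure h2.1
  rw [memLp_two_iff_integrable_sq_norm h0]
  exact ((memLp_two_iff_integrable_sq_norm h1.1).1 h1).add_measure
    ((memLp_two_iff_integrable_sq_norm h2.1).1 h2)

/-- The identification `L²(X) × L²(X) ≃ L²(X ⊔ X)`, `(u, v) ↦ u ⊔ v`. -/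
def glue : (Lp ℂ 2 μ × Lp ℂ 2 μ) ≃ₗ[ℂ] Lp ℂ 2 (sumMeasure μ) where
  toFun w := (memLp_sumElim (Lp.memLp w.1) (Lp.memLp w.2)).toLp
  invFun F := ((memLp_comp_inl (Lp.memLp F)).toLp, (memLp_comp_inr (Lp.memLp F)).toLp)
  map_add' w w' := by
    rw [← MemLp.toLp_add, MemLp.toLp_eq_toLp_iff]
    refine ae_sumMeasure.2 ⟨?_, ?_⟩
    · filter_upwards [Lp.coeFn_add w.1 w'.1] with x hx using by simpa using hx
    · filter_upwards [Lp.coeFn_add w.2 w'.2] with x hx using by simpa using hx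
  map_smul' c w := by
    rw [RingHom.id_apply, ← MemLp.toLp_const_smul, MemLp.toLp_eq_toLp_iff]
    refine ae_sumMeasure.2 ⟨?_, ?_⟩
    · filter_upwards [Lp.coeFn_smul c w.1] with x hx using by simpa using hx
    · filter_upwards [Lp.coeFn_smul c w.2] with x hx using by simpa using hx
  left_inv w := by
    have h := ae_sumMeasure.1
      (memLp_sumElim (Lp.memLp w.1) (Lp.memLp w.2)).coeFn_toLp
    refine Prod.ext (Lp.ext ?_) (Lp.ext ?_)
    · exact (memLp_comp_inl (Lp.memLp _)).coeFn_toLp.trans h.1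
    · exact (memLp_comp_inr (Lp.memLp _)).coeFn_toLp.trans h.2
  right_inv F := by
    refine Lp.ext ((MemLp.coeFn_toLp _).trans (ae_sumMeasure.2 ⟨?_, ?_⟩))
    · exact (memLp_comp_inl (Lp.memLp F)).coeFn_toLp
    · exact (memLp_comp_inr (Lp.memLp F)).coeFn_toLp

end Glue

/-! ### Sobolev spaces on the unit interval and the Dirichlet Laplacian -/

/-- The open unit interval, with the metric inherited from `ℝ`. -/
abbrev I : Type := Ioo (0 : ℝ) 1

/-- Lebesgue measure on the open unit interval. -/
abbrev lebI : Measure I := (volume : Measure ℝ).comap Subtype.val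

/-- The complex Hilbert space `L²(0,1)`. -/
abbrev L2I : Type := Lp ℂ 2 lebI

instance : IsFiniteMeasure lebI := by
  refine ⟨?_⟩
  rw [comap_subtype_coe_apply measurableSet_Ioo, image_univ, Subtype.range_coe]
  exact measure_Ioo_lt_top

/-- Test functions: the elements of `C_c^∞((0,1); ℂ)`, extended by `0` to `ℝ`. -/
structure IsTest (φ : ℝ → ℂ) : Prop where
  contDiff : ContDiff ℝ ∞ φ
  hasCompactSupport : HasCompactSupport φ
  tsupport_subset : tsupport φ ⊆ Ioo (0 : ℝ) 1

theorem IsTest.add {φ ψ : ℝ → ℂ} (hφ : IsTest φ) (hψ : IsTest ψ) : IsTest (φ + ψ) :=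
  ⟨hφ.1.add hψ.1, hφ.2.add hψ.2,
    (tsupport_add φ ψ).trans (union_subset hφ.3 hψ.3)⟩

theorem IsTest.smul {φ : ℝ → ℂ} (c : ℂ) (hφ : IsTest φ) : IsTest (c • φ) :=
  ⟨contDiff_const.smul hφ.1, hφ.2.smul_left (f := fun _ => c),
    (closure_mono (Function.support_const_smul_subset c φ)).trans hφ.3⟩

theorem IsTest.zero : IsTest 0 :=
  ⟨contDiff_const, HasCompactSupport.zero, by simp [tsupport]⟩

theorem IsTest.deriv {φ : ℝ → ℂ} (hφ : IsTest φ) : IsTest (deriv φ) :=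
  ⟨((contDiff_infty_iff_deriv (𝕜 := ℝ)).1 hφ.1).2, hφ.2.deriv,
    (tsupport_deriv_subset (𝕜 := ℝ)).trans hφ.3⟩

theorem IsTest.memLp {φ : ℝ → ℂ} (hφ : IsTest φ) : MemLp (fun x : I => φ x) 2 lebI := by
  obtain ⟨C, hC⟩ := hφ.1.continuous.bounded_above_of_compact_support hφ.2
  exact MemLp.of_bound (hφ.1.continuous.comp continuous_subtype_val).aestronglyMeasurable C
    (Eventually.of_forall fun x => hC x)

theorem integrable_mul_test (f : L2I) {φ : ℝ → ℂ} (hφ : IsTest φ) :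
    Integrable (fun x : I => f x * φ x) lebI :=
  (Lp.memLp f).integrable_mul hφ.memLp

/-- `g` is the weak derivative of `f` on `(0,1)`. -/
def HasWeakDeriv (f g : L2I) : Prop :=
  ∀ φ : ℝ → ℂ, IsTest φ → ∫ x : I, f x * deriv φ x ∂lebI = -∫ x : I, g x * φ x ∂lebI

theorem integral_add_mul_test (f g : L2I) {φ : ℝ → ℂ} (hφ : IsTest φ) :
    ∫ x : I, (f + g) x * φ x ∂lebI = ∫ x : I, f x * φ x ∂lebI + ∫ x : I, g x * φ x ∂lebI := by
  rw [← integral_add (integrable_mul_test f hφ) (integrable_mul_test g hφ)]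
  refine integral_congr_ae ?_
  filter_upwards [Lp.coeFn_add f g] with x hx
  rw [hx, Pi.add_apply, add_mul]

theorem integral_smul_mul_test (c : ℂ) (f : L2I) (φ : ℝ → ℂ) :
    ∫ x : I, (c • f) x * φ x ∂lebI = c * ∫ x : I, f x * φ x ∂lebI := by
  rw [← integral_const_mul]
  refine integral_congr_ae ?_
  filter_upwards [Lp.coeFn_smul c f] with x hx
  rw [hx, Pi.smul_apply, smul_eq_mul, mul_assoc]

theorem integral_zero_mul_test (φ : ℝ → ℂ) : ∫ x : I, (0 : L2I) x * φ x ∂lebI = 0 := by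
  have h := integral_smul_mul_test 0 (0 : L2I) φ
  rwa [zero_smul, zero_mul] at h

/-- The graph of the weak derivative as an operator in `L²(0,1)`. -/
def weakDerivGraph : Submodule ℂ (L2I × L2I) where
  carrier := {q | HasWeakDeriv q.1 q.2}
  zero_mem' φ _ := by
    rw [Prod.fst_zero, Prod.snd_zero, integral_zero_mul_test, integral_zero_mul_test, neg_zero]
  add_mem' {a b} ha hb φ hφ := by
    rw [Prod.fst_add, Prod.snd_add, integral_add_mul_test _ _ hφ.deriv,
      integral_add_mul_test _ _ hφ, ha φ hφ, hb φ hφ, neg_add]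
  smul_mem' c a ha φ hφ := by
    rw [Prod.smul_fst, Prod.smul_snd, integral_smul_mul_test, integral_smul_mul_test,
      ha φ hφ, mul_neg]

/-- Weak derivatives are unique. -/
theorem weakDerivGraph_functional :
    ∀ q ∈ weakDerivGraph, q.1 = 0 → q.2 = 0 := by
  rintro ⟨f, g⟩ hq rfl
  change g = 0
  have he : MeasurableEmbedding (Subtype.val : I → ℝ) :=
    MeasurableEmbedding.subtype_coe measurableSet_Ioo
  have hmap : lebI.map Subtype.val = (volume : Measure ℝ).restrict (Ioo 0 1) := by
    rw [map_comap_subtype_coe measurableSet_Ioo]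
  set G : ℝ → ℂ := Function.extend Subtype.val g 0 with hG
  have hGx : ∀ x : I, G x = g x := fun x => Subtype.val_injective.extend_apply _ _ x
  have hint : IntegrableOn G (Ioo (0 : ℝ) 1) := by
    rw [IntegrableOn, ← hmap, he.integrable_map_iff]
    refine ((Lp.memLp g).integrable one_le_two).congr (Eventually.of_forall fun x => ?_)
    exact (hGx x).symm
  have key := isOpen_Ioo.ae_eq_zero_of_integral_contDiff_smul_eq_zero (μ := volume)
    hint.locallyIntegrableOn (fun ψ hψ hc hs => by
      have hφ : IsTest (fun x => (ψ x : ℂ)) :=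
        ⟨Complex.ofRealCLM.contDiff.comp hψ, hc.comp_left (g := fun r : ℝ => (r : ℂ)) (by simp),
          (tsupport_comp_subset (g := fun r : ℝ => (r : ℂ)) (by simp) ψ).trans hs⟩
      have h := hq _ hφ
      simp only [integral_zero_mul_test] at h
      rw [← setIntegral_eq_integral_of_forall_compl_eq_zero (s := Ioo (0 : ℝ) 1), ← hmap,
        he.integral_map]
      · rw [← neg_eq_zero, h]
        refine congrArg _ (integral_congr_ae (Eventually.of_forall fun x => ?_))
        simp [hGx, mul_comm]
      · intro x hx
        rw [image_eq_zero_of_notMem_tsupport fun h => hx (hs h), zero_smul])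
  have h2 : ∀ᵐ x : I ∂lebI, G x = 0 := by
    have h3 : ∀ᵐ x ∂(volume : Measure ℝ).restrict (Ioo 0 1), G x = 0 :=
      (ae_restrict_iff' measurableSet_Ioo).2 key
    rwa [← hmap, he.ae_map_iff] at h3
  refine Lp.ext ?_
  filter_upwards [h2, Lp.coeFn_zero ℂ 2 lebI] with x hx h0
  rw [h0, ← hGx, hx, Pi.zero_apply]

/-- The weak derivative `f ↦ f'` as an operator in `L²(0,1)`. Its domain is `H¹(0,1)`. -/
def weakDeriv : L2I →ₗ.[ℂ] L2I := weakDerivGraph.toLinearPMap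

/-- The Sobolev space `H¹(0,1)`. -/
def H1 : Submodule ℂ L2I := weakDeriv.domain

theorem mem_H1_iff {f : L2I} : f ∈ H1 ↔ ∃ g, HasWeakDeriv f g := by
  change f ∈ weakDerivGraph.map (LinearMap.fst ℂ L2I L2I) ↔ _
  constructor
  · rintro ⟨q, hq, rfl⟩
    exact ⟨q.2, hq⟩
  · rintro ⟨g, hg⟩
    exact ⟨(f, g), hg, rfl⟩

theorem hasWeakDeriv_weakDeriv (f : weakDeriv.domain) : HasWeakDeriv f (weakDeriv f) :=
  Submodule.mem_graph_toLinearPMap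
    (fun q hq h => weakDerivGraph_functional q hq h) f

/-- The Sobolev space `H²(0,1)`: all `f ∈ H¹(0,1)` with `f' ∈ H¹(0,1)`. -/
def H2 : Submodule ℂ L2I := (H1.comap weakDeriv.toFun).map weakDeriv.domain.subtype

theorem mem_H2_iff {f : L2I} :
    f ∈ H2 ↔ ∃ h : f ∈ weakDeriv.domain, weakDeriv ⟨f, h⟩ ∈ weakDeriv.domain := by
  constructor
  · rintro ⟨q, hq, rfl⟩
    exact ⟨q.2, hq⟩
  · rintro ⟨h, hg⟩
    exact ⟨⟨f, h⟩, hg, rfl⟩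

/-- All pairs `(φ, φ')` in `L²(0,1) × L²(0,1)`, with `φ` a test function. -/
def testGraph : Submodule ℂ (L2I × L2I) where
  carrier := {q | ∃ φ : ℝ → ℂ, IsTest φ ∧
    (∀ᵐ x : I ∂lebI, q.1 x = φ x) ∧ (∀ᵐ x : I ∂lebI, q.2 x = deriv φ x)}
  zero_mem' := by
    refine ⟨0, IsTest.zero, ?_, ?_⟩
    · filter_upwards [Lp.coeFn_zero ℂ 2 lebI] with x hx using by simpa using hx
    · filter_upwards [Lp.coeFn_zero ℂ 2 lebI] with x hx using by simpa using hx
  add_mem' := by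
    rintro a b ⟨φ, hφ, h1, h2⟩ ⟨ψ, hψ, h3, h4⟩
    refine ⟨φ + ψ, hφ.add hψ, ?_, ?_⟩
    · filter_upwards [Lp.coeFn_add a.1 b.1, h1, h3] with x hx h h'
      rw [Prod.fst_add, hx, Pi.add_apply, Pi.add_apply, h, h']
    · filter_upwards [Lp.coeFn_add a.2 b.2, h2, h4] with x hx h h'
      rw [Prod.snd_add, hx, Pi.add_apply, h, h',
        deriv_add (hφ.1.differentiable (by simp) _) (hψ.1.differentiable (by simp) _)]
  smul_mem' := by
    rintro c a ⟨φ, hφ, h1, h2⟩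
    refine ⟨c • φ, hφ.smul c, ?_, ?_⟩
    · filter_upwards [Lp.coeFn_smul c a.1, h1] with x hx h
      rw [Prod.smul_fst, hx, Pi.smul_apply, Pi.smul_apply, h]
    · filter_upwards [Lp.coeFn_smul c a.2, h2] with x hx h
      rw [Prod.smul_snd, hx, Pi.smul_apply, h,
        deriv_const_smul c (hφ.1.differentiable (by simp) _)]

/-- The Sobolev space `H¹₀(0,1)`: the closure of the test functions in `H¹(0,1)`, that is, all
`f ∈ H¹(0,1)` such that `(f, f')` is a limit in `L² × L²` of pairs `(φ, φ')` with `φ` a test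
function. -/
def H10 : Submodule ℂ L2I :=
  (testGraph.topologicalClosure.comap
    (weakDeriv.domain.subtype.prod weakDeriv.toFun)).map weakDeriv.domain.subtype

theorem mem_H10_iff {f : L2I} : f ∈ H10 ↔
    ∃ h : f ∈ weakDeriv.domain, (f, weakDeriv ⟨f, h⟩) ∈ closure (testGraph : Set (L2I × L2I)) := by
  constructor
  · rintro ⟨q, hq, rfl⟩
    exact ⟨q.2, hq⟩
  · rintro ⟨h, hg⟩
    exact ⟨⟨f, h⟩, hg, rfl⟩

/-- The positive Dirichlet Laplacian `Δ f = -f''` in `L²(0,1)`, with domain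
`D(Δ) = H²(0,1) ∩ H¹₀(0,1)`. -/
def dirichletLaplacian : L2I →ₗ.[ℂ] L2I where
  domain := H2 ⊓ H10
  toFun :=
    { toFun := fun f =>
        -weakDeriv ⟨weakDeriv ⟨f, (mem_H2_iff.1 f.2.1).1⟩, (mem_H2_iff.1 f.2.1).2⟩
      map_add' := fun f g => by
        rw [← neg_add, ← LinearPMap.map_add]
        congr 2
        exact Subtype.ext (LinearPMap.map_add weakDeriv ⟨f, (mem_H2_iff.1 f.2.1).1⟩
          ⟨g, (mem_H2_iff.1 g.2.1).1⟩)
      map_smul' := fun c f => by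
        rw [RingHom.id_apply, smul_neg, ← LinearPMap.map_smul]
        congr 2
        exact Subtype.ext (LinearPMap.map_smul weakDeriv c ⟨f, (mem_H2_iff.1 f.2.1).1⟩) }

/-! ### The operator matrix -/

/-- The space `𝕏 = (0,1) ⊔ (0,1)`, with the generalized metric `sumDist`. -/
abbrev 𝕏 : Type := I ⊕ I

/-- The canonical measure of `𝕏`: Lebesgue measure on each of the two copies of `(0,1)`. -/
abbrev leb𝕏 : Measure 𝕏 := sumMeasure lebI

/-- The complex Hilbert space `L²(𝕏)`. -/
abbrev L2𝕏 : Type := Lp ℂ 2 leb𝕏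

/-- The subspace `D(Δ) × D(Δ)` of `L²(𝕏) ≃ L²(0,1) × L²(0,1)`. -/
def waveDomain : Submodule ℂ L2𝕏 :=
  (dirichletLaplacian.domain.prod dirichletLaplacian.domain).comap
    (glue (μ := lebI)).symm.toLinearMap

/-- The first component `u ∈ D(Δ)` of `u ⊔ v ∈ D(Δ) × D(Δ)`. -/
def waveFst : waveDomain →ₗ[ℂ] dirichletLaplacian.domain :=
  (LinearMap.fst ℂ L2I L2I ∘ₗ (glue (μ := lebI)).symm.toLinearMap ∘ₗ
    waveDomain.subtype).codRestrict _ fun F => F.2.1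

/-- The second component `v ∈ D(Δ)` of `u ⊔ v ∈ D(Δ) × D(Δ)`. -/
def waveSnd : waveDomain →ₗ[ℂ] dirichletLaplacian.domain :=
  (LinearMap.snd ℂ L2I L2I ∘ₗ (glue (μ := lebI)).symm.toLinearMap ∘ₗ
    waveDomain.subtype).codRestrict _ fun F => F.2.2

/-- The operator matrix `[[0, Δ], [-Δ, -Δ]]` on `L²(𝕏) ≃ L²(0,1) × L²(0,1)`, with domain
`D(Δ) × D(Δ)`: it maps `u ⊔ v` to `Δ v ⊔ (-Δ u - Δ v)`. -/
def waveOp : L2𝕏 →ₗ.[ℂ] L2𝕏 where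
  domain := waveDomain
  toFun := (glue (μ := lebI)).toLinearMap ∘ₗ
    (dirichletLaplacian.toFun ∘ₗ waveSnd).prod
      (-(dirichletLaplacian.toFun ∘ₗ waveFst) - dirichletLaplacian.toFun ∘ₗ waveSnd)

theorem waveOp_glue (u v : dirichletLaplacian.domain)
    (h : glue ((u : L2I), (v : L2I)) ∈ waveDomain) :
    waveOp ⟨glue ((u : L2I), (v : L2I)), h⟩ =
      glue (dirichletLaplacian v, -dirichletLaplacian u - dirichletLaplacian v) := by
  have h1 : waveFst ⟨glue ((u : L2I), (v : L2I)), h⟩ = u :=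
    Subtype.ext (congrArg Prod.fst (glue.symm_apply_apply ((u : L2I), (v : L2I))))
  have h2 : waveSnd ⟨glue ((u : L2I), (v : L2I)), h⟩ = v :=
    Subtype.ext (congrArg Prod.snd (glue.symm_apply_apply ((u : L2I), (v : L2I))))
  exact congrArg₂ (fun a b => glue
    (dirichletLaplacian b, -dirichletLaplacian a - dirichletLaplacian b)) h1 h2

/-! ### Semigroups, integral kernels, Lipschitz continuity -/

/-- `T` (of which only the values at `t ≥ 0` matter) is a strongly continuous semigroup of bounded
linear operators on `E`. -/
structure IsC0Semigroup {E : Type*} [NormedAddCommGroup E] [NormedSpace ℂ E]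
    (T : ℝ → E →L[ℂ] E) : Prop where
  map_zero : T 0 = ContinuousLinearMap.id ℂ E
  map_add : ∀ s t : ℝ, 0 ≤ s → 0 ≤ t → T (s + t) = (T s).comp (T t)
  tendsto_zero : ∀ f : E, Tendsto (fun t => T t f) (𝓝[>] 0) (𝓝 f)

/-- `T` is the strongly continuous semigroup generated by the operator `A`: the domain of `A`
consists of all `f` for which `(T(h) f - f) / h` converges as `h → 0+`, and the limit is `A f`. -/
structure IsSemigroupGeneratedBy {E : Type*} [NormedAddCommGroup E] [NormedSpace ℂ E]
    (A : E →ₗ.[ℂ] E) (T : ℝ → E →L[ℂ] E) : Prop where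
  isC0Semigroup : IsC0Semigroup T
  mem_graph_iff : ∀ f g : E, (f, g) ∈ A.graph ↔
    Tendsto (fun h : ℝ => ((h⁻¹ : ℝ) : ℂ) • (T h f - f)) (𝓝[>] 0) (𝓝 g)

/-- `k` is an integral kernel of the operator `S` on `L²(Y)`. -/
structure IsIntegralKernel {Y : Type*} [MeasurableSpace Y] {μ : Measure Y}
    (S : Lp ℂ 2 μ →L[ℂ] Lp ℂ 2 μ) (k : Y → Y → ℂ) : Prop where
  measurable : Measurable (Function.uncurry k)
  integrable : ∀ f : Lp ℂ 2 μ, ∀ᵐ x ∂μ, Integrable (fun y => k x y * f y) μ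
  apply_eq : ∀ f : Lp ℂ 2 μ, ∀ᵐ x ∂μ, S f x = ∫ y, k x y * f y ∂μ

/-- The graph norm of an operator, on its domain. -/
def graphNorm {E : Type*} [NormedAddCommGroup E] [NormedSpace ℂ E] (A : E →ₗ.[ℂ] E)
    (u : A.domain) : ℝ :=
  ‖(u : E)‖ + ‖A u‖

/-- `f` is a bounded Lipschitz continuous function on the generalized metric space `(Y, d)`, with
values in the vector space `E` with the norm `N`; that is, `f ∈ C^{0,1}(Y; E)`. -/
def IsBoundedLipschitz {Y E : Type*} [AddCommGroup E] (d : Y → Y → ℝ≥0∞) (N : E → ℝ)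
    (f : Y → E) : Prop :=
  (∃ M : ℝ, ∀ y, N (f y) ≤ M) ∧
    ∃ L : ℝ≥0, ∀ y y', y ≠ y' → ENNReal.ofReal (N (f y - f y')) ≤ L * d y y'

end DampedWave
end

/-!
The proof is an eigenfunction expansion. The functions `eₙ(x) = √2 sin ((n + 1) π x)` (`eigfun`)
form a Hilbert basis of `L²(0,1)`, and the Dirichlet Laplacian is the diagonal operator with the
eigenvalues `λₙ = ((n + 1) π)²` on its maximal domain
(`mem_dirichletLaplacian_graph_iff_inner`). This rests on three facts: the Laplacian is symmetric
and closed, both of which follow from integration by parts against `H¹₀` in weak form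
(`HasWeakDeriv.inner_eq`); the `eₙ` lie in `H¹₀`, by a cutoff near the boundary
(`mem_closure_testGraph`); and they are complete, because a function orthogonal to all of them is,
after multiplication by `sin (π x)`, orthogonal to all polynomials in `cos (π x)`
(`eq_zero_of_inner_eig_eq_zero`).

Hence the operator matrix acts on `c ⊗ eₙ`, `c ∈ ℂ²`, as `λₙ M` with `M = [[0, 1], [-1, -1]]`. The
eigenvalues of `M` are the two primitive cube roots of unity, so they have real part `-1/2`, and in
eigenvector coordinates the operator decouples into two diagonal operators with spectrum in the
left half-plane. This gives the semigroup (`exists_waveSemigroup`). Conversely any semigroup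
generated by the operator matrix acts on an eigenvector of its generator by an exponential
(`IsSemigroupGeneratedBy.apply_eigenvector`), which determines it as `exp (t λₙ M)` on `c ⊗ eₙ`
(`waveSemigroup_mode`).

The kernel is therefore `p_t(z, w) = ∑ₙ exp (t λₙ M)_{ij} eₙ(x) eₙ(y)`, for `z` and `w` the points
`x` and `y` of the `i`-th and the `j`-th copy of `(0,1)`. Applying the operator costs a factor `λₙ`
and a Lipschitz estimate for `eₙ` a factor `√λₙ`, while `‖exp (t λₙ M)‖` decays like
`exp (-t λₙ / 2)`. So every series in question converges absolutely, with the common majorant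
`λₙ^(3/2) exp (-t λₙ / 2)`, whose sum is at most `π³ / t²` (`tsum_majorant_le`).
-/

noncomputable section

namespace DampedWave

/-! ### The weak derivative in terms of inner products -/

theorem norm_sq_eq_integral {Y : Type*} [MeasurableSpace Y] {μ : Measure Y} (f : Lp ℂ 2 μ) :
    ‖f‖ ^ 2 = ∫ x, ‖f x‖ ^ 2 ∂μ := by
  have h : ((‖f‖ : ℂ)) ^ 2 = ∫ x, ((‖f x‖ ^ 2 : ℝ) : ℂ) ∂μ := by
    rw [← RCLike.ofReal_eq_complex_ofReal, ← inner_self_eq_norm_sq_to_K (𝕜 := ℂ) f, L2.inner_def]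
    refine integral_congr_ae (Eventually.of_forall fun x => ?_)
    simp only [inner_self_eq_norm_sq_to_K (𝕜 := ℂ)]
    norm_cast
  rw [integral_complex_ofReal] at h
  exact_mod_cast h

theorem inner_toLp {Y : Type*} [MeasurableSpace Y] {μ : Measure Y} {φ : Y → ℂ}
    (hφ : MemLp φ 2 μ) (f : Lp ℂ 2 μ) :
    inner ℂ hφ.toLp f = ∫ x, f x * starRingEnd ℂ (φ x) ∂μ := by
  rw [L2.inner_def]
  refine integral_congr_ae ?_
  filter_upwards [hφ.coeFn_toLp] with x hx
  rw [hx, RCLike.inner_apply]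

/-- Dominated convergence in `L²`, for uniformly bounded functions on a finite measure space. -/
theorem tendsto_toLp_of_bounded {Y : Type*} [MeasurableSpace Y] {μ : Measure Y}
    [IsFiniteMeasure μ] {F : ℕ → Y → ℂ} {G : Y → ℂ} (hF : ∀ k, MemLp (F k) 2 μ)
    (hG : MemLp G 2 μ) (C : ℝ) (hC : ∀ k x, ‖F k x - G x‖ ≤ C)
    (hlim : ∀ᵐ x ∂μ, Tendsto (fun k => F k x) atTop (𝓝 (G x))) :
    Tendsto (fun k => (hF k).toLp) atTop (𝓝 hG.toLp) := by
  rw [tendsto_iff_norm_sub_tendsto_zero]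
  have h2 : Tendsto (fun k => ‖(hF k).toLp - hG.toLp‖ ^ 2) atTop (𝓝 0) := by
    have h : ∀ k, ‖(hF k).toLp - hG.toLp‖ ^ 2 = ∫ x, ‖F k x - G x‖ ^ 2 ∂μ := fun k => by
      rw [norm_sq_eq_integral]
      refine integral_congr_ae ?_
      filter_upwards [Lp.coeFn_sub (hF k).toLp hG.toLp, (hF k).coeFn_toLp, hG.coeFn_toLp]
        with x h1 h2 h3
      rw [h1, Pi.sub_apply, h2, h3]
    simp only [h]
    rw [← integral_zero Y ℝ (μ := μ)]
    refine tendsto_integral_of_dominated_convergence (fun _ => C ^ 2) (fun k => ?_)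
      (integrable_const _) (fun k => Eventually.of_forall fun x => ?_) ?_
    · exact ((hF k).1.sub hG.1).norm.pow 2
    · rw [norm_pow, norm_norm]
      exact pow_le_pow_left₀ (norm_nonneg _) (hC k x) 2
    · filter_upwards [hlim] with x hx
      have := (tendsto_iff_norm_sub_tendsto_zero.1 hx).pow 2
      simpa using this
  have h3 := h2.sqrt
  simpa [Real.sqrt_sq] using h3

/-- The class in `L²(0,1)` of a continuous function on the line. -/
def ofCont (f : ℝ → ℂ) (hf : Continuous f) : L2I :=
  MemLp.toLp (fun x : I => f x) (by
    obtain ⟨C, hC⟩ := isCompact_Icc.exists_bound_of_continuousOn (s := Icc (0 : ℝ) 1)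
      hf.continuousOn
    exact MemLp.of_bound (hf.comp continuous_subtype_val).aestronglyMeasurable C
      (Eventually.of_forall fun x => hC x (Ioo_subset_Icc_self x.2)))

theorem coeFn_ofCont (f : ℝ → ℂ) (hf : Continuous f) :
    ∀ᵐ x : I ∂lebI, ofCont f hf x = f x :=
  MemLp.coeFn_toLp _

theorem inner_ofCont (f : ℝ → ℂ) (hf : Continuous f) (g : L2I) :
    inner ℂ (ofCont f hf) g = ∫ x : I, g x * starRingEnd ℂ (f x) ∂lebI :=
  inner_toLp _ _

theorem IsTest.conj {φ : ℝ → ℂ} (hφ : IsTest φ) : IsTest (fun x => starRingEnd ℂ (φ x)) :=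
  ⟨Complex.conjCLE.contDiff.comp hφ.1, hφ.2.comp_left (g := starRingEnd ℂ) (by simp),
    (tsupport_comp_subset (g := starRingEnd ℂ) (by simp) φ).trans hφ.3⟩

theorem deriv_conj_eq {φ : ℝ → ℂ} (hφ : Differentiable ℝ φ) (x : ℝ) :
    deriv (fun x => starRingEnd ℂ (φ x)) x = starRingEnd ℂ (deriv φ x) :=
  (Complex.conjCLE.toContinuousLinearMap.hasFDerivAt.comp_hasDerivAt x (hφ x).hasDerivAt).deriv

theorem IsTest.mem_testGraph {φ : ℝ → ℂ} (hφ : IsTest φ) :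
    (ofCont φ hφ.1.continuous, ofCont (_root_.deriv φ) hφ.deriv.1.continuous) ∈ testGraph :=
  ⟨φ, hφ, coeFn_ofCont φ hφ.1.continuous, coeFn_ofCont (_root_.deriv φ) hφ.deriv.1.continuous⟩

/-- Since the complex conjugate of a test function is a test function, the bilinear pairings in
the definition of the weak derivative can be replaced by inner products. -/
theorem hasWeakDeriv_iff {f g : L2I} :
    HasWeakDeriv f g ↔ ∀ q ∈ testGraph, inner ℂ q.2 f = -inner ℂ q.1 g := by
  constructor
  · rintro h ⟨a, b⟩ ⟨φ, hφ, h1, h2⟩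
    have h3 := h _ hφ.conj
    rw [L2.inner_def, L2.inner_def]
    convert h3 using 1
    · refine integral_congr_ae ?_
      filter_upwards [h2] with x hx
      rw [hx, deriv_conj_eq (hφ.1.differentiable (by simp)), RCLike.inner_apply]
    · congr 1
      refine integral_congr_ae ?_
      filter_upwards [h1] with x hx
      rw [hx, RCLike.inner_apply]
  · intro h φ hφ
    have h3 := h _ hφ.conj.mem_testGraph
    simp only [inner_ofCont] at h3
    simpa only [deriv_conj_eq (hφ.1.differentiable (by simp)), Complex.conj_conj] using h3

/-- Integration by parts against elements of the closure of the test functions in `H¹(0,1)`. -/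
theorem HasWeakDeriv.inner_eq {f g : L2I} (h : HasWeakDeriv f g) {q : L2I × L2I}
    (hq : q ∈ closure (testGraph : Set (L2I × L2I))) : inner ℂ q.2 f = -inner ℂ q.1 g := by
  have hc : IsClosed {q : L2I × L2I | inner ℂ q.2 f = -inner ℂ q.1 g} :=
    isClosed_eq (by fun_prop) (by fun_prop)
  exact closure_minimal (fun q hq => hasWeakDeriv_iff.1 h q hq) hc hq

theorem isClosed_weakDerivGraph : IsClosed {q : L2I × L2I | HasWeakDeriv q.1 q.2} := by
  have e : {q : L2I × L2I | HasWeakDeriv q.1 q.2} =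
      ⋂ q ∈ testGraph, {p : L2I × L2I | inner ℂ q.2 p.1 = -inner ℂ q.1 p.2} := by
    ext p
    simp [hasWeakDeriv_iff]
  rw [e]
  exact isClosed_iInter fun q => isClosed_iInter fun _ =>
    isClosed_eq (by fun_prop) (by fun_prop)

theorem HasWeakDeriv.mem_domain {f g : L2I} (h : HasWeakDeriv f g) : f ∈ weakDeriv.domain :=
  mem_H1_iff.2 ⟨g, h⟩

theorem HasWeakDeriv.eq {f g g' : L2I} (h : HasWeakDeriv f g) (h' : HasWeakDeriv f g') :
    g = g' := by
  have h1 : (f, g) - (f, g') ∈ weakDerivGraph := weakDerivGraph.sub_mem h h'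
  exact sub_eq_zero.1 (weakDerivGraph_functional _ h1 (sub_self f))

theorem HasWeakDeriv.weakDeriv_eq {f g : L2I} (h : HasWeakDeriv f g) :
    weakDeriv ⟨f, h.mem_domain⟩ = g :=
  (hasWeakDeriv_weakDeriv ⟨f, h.mem_domain⟩).eq h

theorem integral_I (F : ℝ → ℂ) : ∫ x : I, F x ∂lebI = ∫ x in Ioo (0 : ℝ) 1, F x :=
  integral_subtype_comap measurableSet_Ioo F

/-- Classical derivatives are weak derivatives. -/
theorem hasWeakDeriv_ofCont {f f' : ℝ → ℂ} (hf : ∀ x, HasDerivAt f (f' x) x)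
    (hc : Continuous f) (hf' : Continuous f') : HasWeakDeriv (ofCont f hc) (ofCont f' hf') := by
  intro φ hφ
  have e1 : ∫ x : I, ofCont f hc x * deriv φ x ∂lebI = ∫ x, f x * deriv φ x := by
    rw [← setIntegral_eq_integral_of_forall_compl_eq_zero (s := Ioo (0 : ℝ) 1), ← integral_I]
    · refine integral_congr_ae ?_
      filter_upwards [coeFn_ofCont f hc] with x hx
      rw [hx]
    · intro x hx
      rw [image_eq_zero_of_notMem_tsupport fun h => hx (hφ.deriv.3 h), mul_zero]
  have e2 : ∫ x : I, ofCont f' hf' x * φ x ∂lebI = ∫ x, f' x * φ x := by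
    rw [← setIntegral_eq_integral_of_forall_compl_eq_zero (s := Ioo (0 : ℝ) 1), ← integral_I]
    · refine integral_congr_ae ?_
      filter_upwards [coeFn_ofCont f' hf'] with x hx
      rw [hx]
    · intro x hx
      rw [image_eq_zero_of_notMem_tsupport fun h => hx (hφ.3 h), mul_zero]
  rw [e1, e2]
  refine integral_mul_deriv_eq_deriv_mul_of_integrable (fun x _ => hf x)
    (fun x _ => (hφ.1.differentiable (by simp) x).hasDerivAt) ?_ ?_ ?_
  · exact (hc.mul hφ.deriv.1.continuous).integrable_of_hasCompactSupport hφ.deriv.2.mul_left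
  · exact (hf'.mul hφ.1.continuous).integrable_of_hasCompactSupport hφ.2.mul_left
  · exact (hc.mul hφ.1.continuous).integrable_of_hasCompactSupport hφ.2.mul_left

/-! ### The Dirichlet Laplacian is closed -/

/-- The graph of the Dirichlet Laplacian, in terms of weak derivatives. -/
theorem mem_dirichletLaplacian_graph_iff {u g : L2I} :
    (u, g) ∈ dirichletLaplacian.graph ↔ ∃ v, HasWeakDeriv u v ∧ HasWeakDeriv v (-g) ∧
      (u, v) ∈ closure (testGraph : Set (L2I × L2I)) := by
  rw [LinearPMap.mem_graph_iff]
  constructor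
  · rintro ⟨y, hyu, hy⟩
    obtain rfl : (y : L2I) = u := hyu
    change dirichletLaplacian y = g at hy
    obtain ⟨h, h'⟩ := mem_H2_iff.1 y.2.1
    obtain ⟨h1, h2⟩ := mem_H10_iff.1 y.2.2
    refine ⟨_, hasWeakDeriv_weakDeriv ⟨y, h⟩, ?_, h2⟩
    have h3 : -g = weakDeriv ⟨weakDeriv ⟨y, h⟩, h'⟩ := by
      rw [← hy]
      exact neg_neg _
    rw [h3]
    exact hasWeakDeriv_weakDeriv ⟨weakDeriv ⟨y, h⟩, h'⟩
  · rintro ⟨v, huv, hvg, hc⟩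
    have e1 := huv.weakDeriv_eq
    have h1 : u ∈ H2 := mem_H2_iff.2 ⟨huv.mem_domain, by rw [e1]; exact hvg.mem_domain⟩
    have h2 : u ∈ H10 := mem_H10_iff.2 ⟨huv.mem_domain, by rw [e1]; exact hc⟩
    refine ⟨⟨u, h1, h2⟩, rfl, ?_⟩
    change -weakDeriv ⟨weakDeriv ⟨u, huv.mem_domain⟩, _⟩ = g
    rw [neg_eq_iff_eq_neg, ← hvg.weakDeriv_eq]
    congr 2

/-- The Dirichlet Laplacian is a closed operator: convergence of `u` and `Δ u` forces convergence
of `u'`. -/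
theorem isClosed_dirichletLaplacian_graph :
    IsClosed (dirichletLaplacian.graph : Set (L2I × L2I)) := by
  refine isClosed_of_closure_subset fun q hq => ?_
  obtain ⟨w, hw, hlim⟩ := mem_closure_iff_seq_limit.1 hq
  have hw' := fun k => mem_dirichletLaplacian_graph_iff.1 (hw k)
  choose v huv hvg hc using hw'
  -- The energy identity `‖v‖² = ⟪u, Δ u⟫` for `v = u'` controls the first derivatives.
  have key : ∀ k l, dist (v k) (v l) ≤ dist (w k) (w l) := by
    intro k l
    have h1 : HasWeakDeriv (v k - v l) (-((w k).2 - (w l).2)) := by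
      have := weakDerivGraph.sub_mem (x := (v k, -(w k).2))
        (y := (v l, -(w l).2)) (hvg k) (hvg l)
      have e : -((w k).2 - (w l).2) = -(w k).2 - -(w l).2 := by abel
      rw [e]
      exact this
    have h2 : ((w k).1 - (w l).1, v k - v l) ∈ closure (testGraph : Set (L2I × L2I)) :=
      testGraph.topologicalClosure.sub_mem (hc k) (hc l)
    have h3 := h1.inner_eq h2
    rw [inner_neg_right, neg_neg] at h3
    have h4 : ‖v k - v l‖ ^ 2 ≤ ‖w k - w l‖ ^ 2 := by
      have h5 : ‖inner ℂ (v k - v l) (v k - v l)‖ = ‖v k - v l‖ ^ 2 := by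
        rw [inner_self_eq_norm_sq_to_K]
        simp
      rw [← h5]
      change ‖inner ℂ (v k - v l) (v k - v l)‖ ≤ _
      rw [show inner ℂ (v k - v l) (v k - v l) = _ from h3, sq]
      exact (norm_inner_le_norm _ _).trans (mul_le_mul (norm_fst_le (w k - w l))
        (norm_snd_le (w k - w l)) (norm_nonneg _) (norm_nonneg _))
    rw [dist_eq_norm, dist_eq_norm]
    exact le_of_sq_le_sq h4 (norm_nonneg _)
  have hcau : CauchySeq v := by
    have := hlim.cauchySeq
    rw [Metric.cauchySeq_iff] at this ⊢
    intro ε hε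
    obtain ⟨N, hN⟩ := this ε hε
    exact ⟨N, fun m hm n hn => (key m n).trans_lt (hN m hm n hn)⟩
  obtain ⟨V, hV⟩ := cauchySeq_tendsto_of_complete hcau
  have h1 : Tendsto (fun k => (w k).1) atTop (𝓝 q.1) := (continuous_fst.tendsto q).comp hlim
  have h2 : Tendsto (fun k => (w k).2) atTop (𝓝 q.2) := (continuous_snd.tendsto q).comp hlim
  exact mem_dirichletLaplacian_graph_iff.2 ⟨V,
    isClosed_weakDerivGraph.mem_of_tendsto (h1.prodMk_nhds hV) (Eventually.of_forall huv),
    isClosed_weakDerivGraph.mem_of_tendsto (hV.prodMk_nhds h2.neg) (Eventually.of_forall hvg),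
    isClosed_closure.mem_of_tendsto (h1.prodMk_nhds hV) (Eventually.of_forall hc)⟩

/-! ### Smooth functions that vanish at the boundary belong to `H¹₀` -/

/-- A smooth function that is `0` on `(-∞, 1]` and `1` on `[2, ∞)`. -/
def cutoff (s : ℝ) : ℝ := Real.smoothTransition (s - 1)

theorem contDiff_cutoff : ContDiff ℝ ∞ cutoff :=
  Real.smoothTransition.contDiff.comp (contDiff_id.sub contDiff_const)

theorem cutoff_eq_zero {s : ℝ} (hs : s ≤ 1) : cutoff s = 0 :=
  Real.smoothTransition.zero_of_nonpos (by linarith)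

theorem cutoff_eq_one {s : ℝ} (hs : 2 ≤ s) : cutoff s = 1 :=
  Real.smoothTransition.one_of_one_le (by linarith)

theorem abs_cutoff_le (s : ℝ) : |cutoff s| ≤ 1 := by
  rw [cutoff, abs_of_nonneg (Real.smoothTransition.nonneg _)]
  exact Real.smoothTransition.le_one _

theorem deriv_cutoff_of_gt {s : ℝ} (hs : 2 < s) : deriv cutoff s = 0 := by
  have h : cutoff =ᶠ[𝓝 s] fun _ => 1 := by
    filter_upwards [Ioi_mem_nhds hs] with r hr using cutoff_eq_one (le_of_lt hr)
  rw [h.deriv_eq, deriv_const]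

theorem deriv_cutoff_of_lt {s : ℝ} (hs : s < 1) : deriv cutoff s = 0 := by
  have h : cutoff =ᶠ[𝓝 s] fun _ => 0 := by
    filter_upwards [Iio_mem_nhds hs] with r hr using cutoff_eq_zero (le_of_lt hr)
  rw [h.deriv_eq, deriv_const]

/-- The derivative of the cutoff is supported in `[1, 2]`, so its product with `s` is bounded. This
makes the derivatives of `χ (κ x (1 - x)) f` bounded uniformly in `κ` if `f` vanishes at `0` and
`1`. -/
theorem exists_bound_deriv_cutoff_mul : ∃ C, ∀ s, |deriv cutoff s * s| ≤ C := by
  have hc : Continuous fun s => deriv cutoff s * s :=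
    (contDiff_cutoff.continuous_deriv (by simp)).mul continuous_id
  have hs : HasCompactSupport fun s => deriv cutoff s * s := by
    refine HasCompactSupport.of_support_subset_isCompact (isCompact_Icc (a := 1) (b := 2)) ?_
    intro s hs
    by_contra h
    rw [mem_Icc, not_and_or, not_le, not_le] at h
    refine hs ?_
    rcases h with h | h
    · simp [deriv_cutoff_of_lt h]
    · simp [deriv_cutoff_of_gt h]
  exact hc.bounded_above_of_compact_support hs

/-- Multiplication by the cutoff `χ (κ x (1 - x))` turns a smooth function into a test function. -/
theorem isTest_cutoff_mul {f : ℝ → ℂ} (hf : ContDiff ℝ ∞ f) {κ : ℝ} (hκ : 0 < κ) :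
    IsTest fun x => (cutoff (κ * (x * (1 - x))) : ℂ) * f x := by
  have hsub : (tsupport fun x => (cutoff (κ * (x * (1 - x))) : ℂ) * f x) ⊆
      {x : ℝ | 1 ≤ κ * (x * (1 - x))} := by
    refine closure_minimal (fun x hx => ?_) (isClosed_le (by fun_prop) (by fun_prop))
    by_contra h
    rw [mem_ofPred_eq, not_le] at h
    exact hx (by simp [cutoff_eq_zero h.le])
  have hI : {x : ℝ | 1 ≤ κ * (x * (1 - x))} ⊆ Ioo 0 1 := by
    intro x hx
    change 1 ≤ κ * (x * (1 - x)) at hx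
    have h1 : 0 < x * (1 - x) := by
      by_contra h
      have := mul_nonpos_of_nonneg_of_nonpos hκ.le (not_lt.1 h)
      linarith
    constructor <;> nlinarith
  refine ⟨?_, ?_, hsub.trans hI⟩
  · exact (Complex.ofRealCLM.contDiff.comp (contDiff_cutoff.comp (contDiff_const.mul
      (contDiff_id.mul (contDiff_const.sub contDiff_id))))).mul hf
  · exact isCompact_Icc.of_isClosed_subset (isClosed_tsupport _)
      ((hsub.trans hI).trans Ioo_subset_Icc_self)

theorem deriv_cutoff_mul {f f' : ℝ → ℂ} (hf : ∀ x, HasDerivAt f (f' x) x) (κ x : ℝ) :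
    deriv (fun x => (cutoff (κ * (x * (1 - x))) : ℂ) * f x) x =
      ((deriv cutoff (κ * (x * (1 - x))) * (κ * (1 - 2 * x)) : ℝ) : ℂ) * f x +
        cutoff (κ * (x * (1 - x))) * f' x := by
  have h1 : HasDerivAt (fun x : ℝ => κ * (x * (1 - x))) (κ * (1 - 2 * x)) x := by
    refine (((hasDerivAt_id x).mul ((hasDerivAt_const x (1 : ℝ)).sub
      (hasDerivAt_id x))).const_mul κ).congr_deriv ?_
    simp only [Pi.sub_apply, id]
    ring
  have h2 : HasDerivAt cutoff (deriv cutoff (κ * (x * (1 - x)))) (κ * (x * (1 - x))) :=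
    (contDiff_cutoff.differentiable (by simp) _).hasDerivAt
  exact (((h2.comp x h1).ofReal_comp).mul (hf x)).deriv

/-- A smooth function `f` that vanishes at the end points belongs to `H¹₀`: the test functions
`χ (κ x (1 - x)) f(x)` converge to `f` in `H¹` as `κ → ∞`. Their derivatives contain the term
`χ' (κ x (1 - x)) κ (1 - 2 x) f(x)`, which stays bounded because `f(x) = O (x (1 - x))`, and which
vanishes at any given point as soon as `κ` is large. -/
theorem mem_closure_testGraph {f f' : ℝ → ℂ} (hf : ContDiff ℝ ∞ f)
    (hf' : ∀ x, HasDerivAt f (f' x) x) (hc' : Continuous f') (C : ℝ)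
    (hC : ∀ x ∈ Ioo (0 : ℝ) 1, ‖f x‖ ≤ C * (x * (1 - x))) :
    (ofCont f hf.continuous, ofCont f' hc') ∈ closure (testGraph : Set (L2I × L2I)) := by
  have hκ : ∀ k : ℕ, (0 : ℝ) < k + 1 := fun k => by positivity
  have hT := fun k => isTest_cutoff_mul hf (hκ k)
  have hev : ∀ x : I, ∀ᶠ k : ℕ in atTop, 2 < ((k : ℝ) + 1) * ((x : ℝ) * (1 - x)) := by
    intro x
    have h0 : 0 < (x : ℝ) * (1 - x) := mul_pos x.2.1 (sub_pos.2 x.2.2)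
    exact ((tendsto_natCast_atTop_atTop.atTop_add tendsto_const_nhds).atTop_mul_const
      h0).eventually_gt_atTop 2
  obtain ⟨D, hD⟩ := exists_bound_deriv_cutoff_mul
  obtain ⟨B, hB⟩ := isCompact_Icc.exists_bound_of_continuousOn (s := Icc (0 : ℝ) 1)
      hf.continuous.continuousOn
  obtain ⟨B', hB'⟩ := isCompact_Icc.exists_bound_of_continuousOn (s := Icc (0 : ℝ) 1)
      hc'.continuousOn
  have hC0 : 0 ≤ C := by
    have h := (norm_nonneg _).trans (hC (1 / 2) ⟨by norm_num, by norm_num⟩)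
    linarith
  have hcut : ∀ (s : ℝ) (z : ℂ), ‖(cutoff s : ℂ) * z‖ ≤ ‖z‖ := fun s z => by
    rw [norm_mul, Complex.norm_real]
    exact mul_le_of_le_one_left (norm_nonneg _) (abs_cutoff_le s)
  refine mem_closure_of_tendsto (b := (atTop : Filter ℕ)) (Tendsto.prodMk_nhds ?_ ?_)
    (Eventually.of_forall fun k : ℕ => (hT k).mem_testGraph)
  · refine tendsto_toLp_of_bounded _ _ (B + B) (fun k x => ?_)
      (Eventually.of_forall fun x => ?_)
    · have hx := hB x (Ioo_subset_Icc_self x.2)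
      exact (norm_sub_le _ _).trans (add_le_add ((hcut _ _).trans hx) hx)
    · refine tendsto_const_nhds.congr' ?_
      filter_upwards [hev x] with k hk
      rw [cutoff_eq_one hk.le, Complex.ofReal_one, one_mul]
  · refine tendsto_toLp_of_bounded _ _ (D * C + B' + B') (fun k x => ?_)
      (Eventually.of_forall fun x => ?_)
    · have hx := hB' x (Ioo_subset_Icc_self x.2)
      rw [deriv_cutoff_mul hf']
      refine (norm_sub_le _ _).trans (add_le_add ((norm_add_le _ _).trans
        (add_le_add ?_ ((hcut _ _).trans hx))) hx)
      have h0 : 0 ≤ (x : ℝ) * (1 - x) := (mul_pos x.2.1 (sub_pos.2 x.2.2)).le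
      have h1 : |1 - 2 * (x : ℝ)| ≤ 1 := by
        rw [abs_le]
        constructor <;> linarith [x.2.1, x.2.2]
      rw [norm_mul, Complex.norm_real, Real.norm_eq_abs]
      have h2 := hD (((k : ℝ) + 1) * ((x : ℝ) * (1 - x)))
      rw [abs_mul, abs_mul, abs_of_pos (hκ k), abs_of_nonneg h0] at h2
      rw [abs_mul, abs_mul, abs_of_pos (hκ k)]
      calc |deriv cutoff ((k + 1) * (x * (1 - x)))| * ((k + 1) * |1 - 2 * (x : ℝ)|) * ‖f x‖
          ≤ |deriv cutoff ((k + 1) * (x * (1 - x)))| * ((k + 1) * 1) * (C * (x * (1 - x))) := by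
            have := hκ k
            gcongr
            exact hC x x.2
        _ = |deriv cutoff ((k + 1) * (x * (1 - x)))| * ((k + 1) * (x * (1 - x))) * C := by ring
        _ ≤ D * C := mul_le_mul_of_nonneg_right h2 hC0
    · refine tendsto_const_nhds.congr' ?_
      filter_upwards [hev x] with k hk
      rw [deriv_cutoff_mul hf', deriv_cutoff_of_gt hk, cutoff_eq_one hk.le]
      simp

/-! ### Eigenfunctions of the Dirichlet Laplacian -/

/-- The `n`-th frequency `(n + 1) π`; indices start at `0`. -/
def freq (n : ℕ) : ℝ := (n + 1) * Real.pi

theorem freq_pos (n : ℕ) : 0 < freq n := mul_pos (by positivity) Real.pi_pos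

/-- The `n`-th normalized eigenfunction `√2 sin ((n + 1) π x)` of the Dirichlet Laplacian. -/
def eigfun (n : ℕ) (x : ℝ) : ℝ := √2 * Real.sin (freq n * x)

theorem eigfun_zero (n : ℕ) : eigfun n 0 = 0 := by simp [eigfun]

theorem eigfun_one (n : ℕ) : eigfun n 1 = 0 := by
  have h := Real.sin_nat_mul_pi (n + 1)
  push_cast at h
  simp [eigfun, freq, h]

theorem sqrt_two_le_two : √2 ≤ (2 : ℝ) := by
  rw [Real.sqrt_le_left (by norm_num)]
  norm_num

theorem abs_eigfun_le (n : ℕ) (x : ℝ) : |eigfun n x| ≤ 2 := by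
  rw [eigfun, abs_mul, abs_of_nonneg (Real.sqrt_nonneg 2)]
  have h := mul_le_mul sqrt_two_le_two (Real.abs_sin_le_one (freq n * x)) (abs_nonneg _)
    (by norm_num)
  linarith

theorem hasDerivAt_eigfun (n : ℕ) (x : ℝ) :
    HasDerivAt (eigfun n) (√2 * (freq n * Real.cos (freq n * x))) x := by
  have h := ((hasDerivAt_id x).const_mul (freq n)).sin.const_mul √2
  refine h.congr_deriv ?_
  simp only [id]
  ring

theorem hasDerivAt_deriv_eigfun (n : ℕ) (x : ℝ) :
    HasDerivAt (fun x => √2 * (freq n * Real.cos (freq n * x))) (-(freq n ^ 2 * eigfun n x)) x := by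
  have h := (((hasDerivAt_id x).const_mul (freq n)).cos.const_mul (freq n)).const_mul √2
  refine h.congr_deriv ?_
  simp only [id, eigfun]
  ring

theorem abs_eigfun_sub_le (n : ℕ) (x y : ℝ) :
    |eigfun n x - eigfun n y| ≤ 2 * freq n * |x - y| := by
  have h := Convex.norm_image_sub_le_of_norm_hasDerivWithin_le (𝕜 := ℝ) (s := univ)
    (C := 2 * freq n)
    (fun x _ => (hasDerivAt_eigfun n x).hasDerivWithinAt) (fun x _ => ?_) convex_univ
    (mem_univ y) (mem_univ x)
  · simpa [Real.norm_eq_abs] using h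
  · rw [Real.norm_eq_abs, abs_mul, abs_mul, abs_of_pos (freq_pos n),
      abs_of_nonneg (Real.sqrt_nonneg 2)]
    exact mul_le_mul sqrt_two_le_two (mul_le_of_le_one_right (freq_pos n).le
      (Real.abs_cos_le_one _)) (by have := freq_pos n; positivity) (by norm_num)

theorem abs_eigfun_le_mul (n : ℕ) {x : ℝ} (hx : x ∈ Ioo (0 : ℝ) 1) :
    |eigfun n x| ≤ 4 * freq n * (x * (1 - x)) := by
  have h0 := abs_eigfun_sub_le n x 0
  have h1 := abs_eigfun_sub_le n x 1
  rw [eigfun_zero, sub_zero, sub_zero, abs_of_pos hx.1] at h0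
  rw [eigfun_one, sub_zero, abs_sub_comm, abs_of_pos (sub_pos.2 hx.2)] at h1
  have hf := freq_pos n
  have h2 := mul_le_mul_of_nonneg_right h0 (sub_pos.2 hx.2).le
  have h3 := mul_le_mul_of_nonneg_left h1 hx.1.le
  nlinarith

theorem contDiff_eigfun (n : ℕ) : ContDiff ℝ ∞ (fun x => (eigfun n x : ℂ)) :=
  Complex.ofRealCLM.contDiff.comp
    (contDiff_const.mul (Real.contDiff_sin.comp (contDiff_const.mul contDiff_id)))

theorem continuous_eigfun (n : ℕ) : Continuous (eigfun n) :=
  continuous_iff_continuousAt.2 fun x => (hasDerivAt_eigfun n x).continuousAt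

/-- The eigenfunction `eigfun n` as an element of `L²(0,1)`. -/
def eig (n : ℕ) : L2I := ofCont (fun x => (eigfun n x : ℂ)) (contDiff_eigfun n).continuous

theorem coeFn_eig (n : ℕ) : ∀ᵐ x : I ∂lebI, eig n x = (eigfun n x : ℂ) :=
  coeFn_ofCont _ (contDiff_eigfun n).continuous

theorem ofCont_smul (c : ℂ) (f : ℝ → ℂ) (hf : Continuous f) :
    ofCont (fun x => c * f x) (continuous_const.mul hf) = c • ofCont f hf := by
  refine Lp.ext ?_
  filter_upwards [coeFn_ofCont (fun x => c * f x) (continuous_const.mul hf), coeFn_ofCont f hf,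
    Lp.coeFn_smul c (ofCont f hf)] with x h1 h2 h3
  rw [h1, h3, Pi.smul_apply, h2, smul_eq_mul]

theorem eig_mem_graph (n : ℕ) :
    (eig n, ((freq n ^ 2 : ℝ) : ℂ) • eig n) ∈ dirichletLaplacian.graph := by
  have hc' : Continuous fun x : ℝ => ((√2 * (freq n * Real.cos (freq n * x)) : ℝ) : ℂ) := by
    fun_prop
  refine mem_dirichletLaplacian_graph_iff.2 ⟨ofCont _ hc', ?_, ?_, ?_⟩
  · exact hasWeakDeriv_ofCont (fun x => (hasDerivAt_eigfun n x).ofReal_comp) _ _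
  · have h := hasWeakDeriv_ofCont (fun x => (hasDerivAt_deriv_eigfun n x).ofReal_comp) hc'
      (by simp only [Complex.ofReal_neg, Complex.ofReal_mul]
          exact (continuous_const.mul (contDiff_eigfun n).continuous).neg)
    convert h
    rw [eig, ← neg_smul, ← ofCont_smul]
    congr 1
    ext x
    push_cast
    ring
  · refine mem_closure_testGraph (contDiff_eigfun n) (fun x => (hasDerivAt_eigfun n x).ofReal_comp)
      hc' (4 * freq n) fun x hx => ?_
    rw [Complex.norm_real]
    exact abs_eigfun_le_mul n hx

/-- The Dirichlet Laplacian is symmetric: for `p = (u, Δ u)` and `q = (v, Δ v)` both sides are equal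
to `⟪u', v'⟫`. -/
theorem inner_graph_symm {p q : L2I × L2I} (hp : p ∈ dirichletLaplacian.graph)
    (hq : q ∈ dirichletLaplacian.graph) : inner ℂ p.1 q.2 = inner ℂ p.2 q.1 := by
  obtain ⟨v, -, h2, h3⟩ := mem_dirichletLaplacian_graph_iff.1 hp
  obtain ⟨w, -, h5, h6⟩ := mem_dirichletLaplacian_graph_iff.1 hq
  have e1 := h5.inner_eq h3
  have e2 := h2.inner_eq h6
  rw [inner_neg_right, neg_neg] at e1 e2
  change inner ℂ v w = inner ℂ p.1 q.2 at e1
  change inner ℂ w v = inner ℂ q.1 p.2 at e2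
  rw [← e1, ← inner_conj_symm, e2, inner_conj_symm]

theorem inner_eig_of_mem_graph {u g : L2I} (h : (u, g) ∈ dirichletLaplacian.graph) (n : ℕ) :
    inner ℂ (eig n) g = ((freq n ^ 2 : ℝ) : ℂ) * inner ℂ (eig n) u := by
  have h1 := inner_graph_symm (eig_mem_graph n) h
  simp only [inner_smul_left, Complex.conj_ofReal] at h1
  exact h1

theorem freq_injective : Function.Injective freq := fun n m h => by
  have := mul_right_cancel₀ Real.pi_ne_zero h
  exact_mod_cast add_right_cancel this

theorem integral_eigfun_sq (n : ℕ) : ∫ x in Ioo (0 : ℝ) 1, eigfun n x ^ 2 = 1 := by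
  rw [← integral_Ioc_eq_integral_Ioo, ← intervalIntegral.integral_of_le zero_le_one]
  have h : ∀ x : ℝ, eigfun n x ^ 2 = 2 * Real.sin (freq n * x) ^ 2 := fun x => by
    rw [eigfun, mul_pow, Real.sq_sqrt (by norm_num)]
  simp only [h]
  rw [intervalIntegral.integral_const_mul,
    intervalIntegral.integral_comp_mul_left (fun x => Real.sin x ^ 2) (freq_pos n).ne',
    integral_sin_sq]
  have hs : Real.sin (freq n) = 0 := by
    have h := Real.sin_nat_mul_pi (n + 1)
    push_cast at h
    exact h
  have := (freq_pos n).ne'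
  simp [hs]
  field_simp

theorem orthonormal_eig : Orthonormal ℂ eig := by
  constructor
  · intro n
    have h : ‖eig n‖ ^ 2 = 1 := by
      rw [norm_sq_eq_integral]
      refine Eq.trans ?_ ((integral_subtype_comap measurableSet_Ioo
        (fun x => eigfun n x ^ 2)).trans (integral_eigfun_sq n))
      refine integral_congr_ae ?_
      filter_upwards [coeFn_eig n] with x hx
      rw [hx, Complex.norm_real, Real.norm_eq_abs, sq_abs]
    exact (pow_eq_one_iff_of_nonneg (norm_nonneg _) two_ne_zero).1 h
  -- Orthogonality follows from the symmetry of the Laplacian, as the eigenvalues are distinct.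
  · intro n m hnm
    have h := inner_eig_of_mem_graph (eig_mem_graph m) n
    rw [inner_smul_right, ← sub_eq_zero, ← sub_mul, ← Complex.ofReal_sub] at h
    refine (mul_eq_zero.1 h).resolve_left ?_
    rw [Complex.ofReal_eq_zero, sub_eq_zero]
    intro h2
    exact hnm (freq_injective ((sq_eq_sq₀ (freq_pos _).le (freq_pos _).le).1 h2)).symm

/-! ### Completeness of the eigenfunctions -/

theorem integrable_mul_cont (f : L2I) {h : ℝ → ℂ} (hh : Continuous h) :
    Integrable (fun x : I => f x * h x) lebI := by
  refine ((Lp.memLp f).integrable_mul (Lp.memLp (ofCont h hh))).congr ?_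
  filter_upwards [coeFn_ofCont h hh] with x hx
  rw [Pi.mul_apply, hx]

theorem integral_mul_sin_eq_zero {f : L2I} (hf : ∀ n, inner ℂ (eig n) f = 0) (k : ℤ) :
    ∫ x : I, f x * ((Real.sin (k * Real.pi * x) : ℝ) : ℂ) ∂lebI = 0 := by
  have hnat : ∀ n : ℕ, ∫ x : I, f x * ((Real.sin ((n + 1) * Real.pi * x) : ℝ) : ℂ) ∂lebI = 0 := by
    intro n
    have h := hf n
    rw [eig, inner_ofCont] at h
    simp only [eigfun, Complex.conj_ofReal] at h
    simp only [Complex.ofReal_mul _ (Real.sin _), mul_left_comm _ ((√2 : ℝ) : ℂ)] at h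
    rw [integral_const_mul] at h
    exact (mul_eq_zero.1 h).resolve_left (by simp)
  rcases k with (_ | n) | n
  · simp
  · simpa using hnat n
  · have h := hnat n
    rw [← neg_eq_zero, ← integral_neg] at h
    rw [← h]
    refine integral_congr_ae (Eventually.of_forall fun x => ?_)
    simp only [Int.cast_negSucc, neg_mul, Real.sin_neg, Complex.ofReal_neg, mul_neg]
    push_cast
    rfl

theorem integral_mul_eq_zero_of_eq {f : L2I} {h h₁ h₂ : ℝ → ℝ} (c : ℝ) (hc₁ : Continuous h₁)
    (hc₂ : Continuous h₂) (z₁ : ∫ x : I, f x * (h₁ x : ℂ) ∂lebI = 0)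
    (z₂ : ∫ x : I, f x * (h₂ x : ℂ) ∂lebI = 0) (e : ∀ x, h x = 1 / 2 * (h₁ x + c * h₂ x)) :
    ∫ x : I, f x * (h x : ℂ) ∂lebI = 0 := by
  have e' : ∀ x : I, f x * (h x : ℂ) =
      (1 / 2 : ℂ) * (f x * (h₁ x : ℂ) + c * (f x * (h₂ x : ℂ))) := fun x => by
    rw [e]
    push_cast
    ring
  simp only [e']
  rw [integral_const_mul, integral_add, integral_const_mul, z₁, z₂, mul_zero, add_zero, mul_zero]
  · exact integrable_mul_cont f (h := fun x => (h₁ x : ℂ)) (by fun_prop)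
  · exact (integrable_mul_cont f (h := fun x => (h₂ x : ℂ)) (by fun_prop)).const_mul _

/-- The product formulas for sine and cosine give the vanishing of the moments against
`sin (π x) cos (π x) ^ j cos (k π x)`. The factor `cos (k π x)` is there for the induction on `j`;
only `k = 0` is used later. -/
theorem integral_mul_sin_mul_cos_pow_mul_cos_eq_zero {f : L2I} (hf : ∀ n, inner ℂ (eig n) f = 0)
    (j : ℕ) : ∀ k : ℤ, ∫ x : I, f x * ((Real.sin (Real.pi * x) * Real.cos (Real.pi * x) ^ j *
      Real.cos (k * Real.pi * x) : ℝ) : ℂ) ∂lebI = 0 := by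
  have h1 : ∀ (k : ℤ) (x : ℝ),
      ((k + 1 : ℤ) : ℝ) * Real.pi * x = k * Real.pi * x + Real.pi * x := by
    intro k x
    push_cast
    ring
  have h2 : ∀ (k : ℤ) (x : ℝ),
      ((k - 1 : ℤ) : ℝ) * Real.pi * x = k * Real.pi * x - Real.pi * x := by
    intro k x
    push_cast
    ring
  induction j with
  | zero =>
    intro k
    refine integral_mul_eq_zero_of_eq (-1)
      (h := fun x => Real.sin (Real.pi * x) * Real.cos (Real.pi * x) ^ 0 *
        Real.cos (k * Real.pi * x))
      (h₁ := fun x => Real.sin ((k + 1 : ℤ) * Real.pi * x))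
      (h₂ := fun x => Real.sin ((k - 1 : ℤ) * Real.pi * x)) (by fun_prop) (by fun_prop)
      (integral_mul_sin_eq_zero hf (k + 1)) (integral_mul_sin_eq_zero hf (k - 1)) fun x => ?_
    rw [h1, h2, Real.sin_add, Real.sin_sub]
    ring
  | succ j ih =>
    intro k
    refine integral_mul_eq_zero_of_eq 1
      (h := fun x => Real.sin (Real.pi * x) * Real.cos (Real.pi * x) ^ (j + 1) *
        Real.cos (k * Real.pi * x))
      (h₁ := fun x => Real.sin (Real.pi * x) * Real.cos (Real.pi * x) ^ j *
        Real.cos ((k + 1 : ℤ) * Real.pi * x))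
      (h₂ := fun x => Real.sin (Real.pi * x) * Real.cos (Real.pi * x) ^ j *
        Real.cos ((k - 1 : ℤ) * Real.pi * x)) (by fun_prop) (by fun_prop) (ih (k + 1)) (ih (k - 1))
      fun x => ?_
    rw [h1, h2, Real.cos_add, Real.cos_sub]
    ring

theorem integral_mul_sin_mul_polynomial_eq_zero {f : L2I} (hf : ∀ n, inner ℂ (eig n) f = 0)
    (p : Polynomial ℝ) : ∫ x : I, f x * ((Real.sin (Real.pi * x) *
      p.eval (Real.cos (Real.pi * x)) : ℝ) : ℂ) ∂lebI = 0 := by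
  induction p using Polynomial.induction_on' with
  | add p q hp hq =>
    simp only [Polynomial.eval_add, mul_add, Complex.ofReal_add]
    rw [integral_add, hp, hq, add_zero]
    · exact integrable_mul_cont f (h := fun x => ((Real.sin (Real.pi * x) *
        p.eval (Real.cos (Real.pi * x)) : ℝ) : ℂ)) (by fun_prop)
    · exact integrable_mul_cont f (h := fun x => ((Real.sin (Real.pi * x) *
        q.eval (Real.cos (Real.pi * x)) : ℝ) : ℂ)) (by fun_prop)
  | monomial j a =>
    have h := integral_mul_sin_mul_cos_pow_mul_cos_eq_zero hf j 0
    have h2 := congrArg (fun z => (a : ℂ) * z) h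
    simp only [mul_zero] at h2
    rw [← integral_const_mul] at h2
    rw [← h2]
    refine integral_congr_ae (Eventually.of_forall fun x => ?_)
    simp only [Polynomial.eval_monomial, Int.cast_zero, zero_mul, Real.cos_zero, mul_one]
    push_cast
    ring

/-- Orthogonality passes from polynomials in `cos (π x)` to continuous functions `ψ`: by the
Weierstrass theorem for `y ↦ ψ (arccos y / π)` on `[-1, 1]`, every continuous function on `[0,1]` is
a uniform limit of polynomials in `cos (π x)`. -/
theorem integral_mul_sin_mul_cont_eq_zero {f : L2I} (hf : ∀ n, inner ℂ (eig n) f = 0)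
    {ψ : ℝ → ℝ} (hψ : Continuous ψ) :
    ∫ x : I, f x * ((Real.sin (Real.pi * x) * ψ x : ℝ) : ℂ) ∂lebI = 0 := by
  have hfi : Integrable (fun x => ‖f x‖) lebI := ((Lp.memLp f).integrable one_le_two).norm
  set N := ∫ x, ‖f x‖ ∂lebI with hN
  have hN0 : 0 ≤ N := integral_nonneg fun _ => norm_nonneg _
  have key : ∀ ε > 0, ‖∫ x : I, f x * ((Real.sin (Real.pi * x) * ψ x : ℝ) : ℂ) ∂lebI‖ ≤
      N * ε := by
    intro ε hε
    obtain ⟨p, hp⟩ := exists_polynomial_near_of_continuousOn (-1) 1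
      (fun y => ψ (Real.arccos y / Real.pi))
      (hψ.comp (Real.continuous_arccos.div_const _)).continuousOn ε hε
    rw [← sub_zero (∫ x : I, f x * ((Real.sin (Real.pi * x) * ψ x : ℝ) : ℂ) ∂lebI),
      ← integral_mul_sin_mul_polynomial_eq_zero hf p, ← integral_sub]
    · rw [hN, ← integral_mul_const]
      refine norm_integral_le_of_norm_le (hfi.mul_const ε) (Eventually.of_forall fun x => ?_)
      rw [← mul_sub, ← Complex.ofReal_sub, norm_mul, Complex.norm_real, ← mul_sub,
        Real.norm_eq_abs, abs_mul]
      refine mul_le_mul_of_nonneg_left ?_ (norm_nonneg _)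
      have h := hp (Real.cos (Real.pi * x)) ⟨Real.neg_one_le_cos _, Real.cos_le_one _⟩
      have hx : Real.arccos (Real.cos (Real.pi * x)) / Real.pi = x := by
        rw [Real.arccos_cos (mul_nonneg Real.pi_pos.le x.2.1.le)
          (mul_le_of_le_one_right Real.pi_pos.le x.2.2.le), mul_div_cancel_left₀ _ Real.pi_ne_zero]
      simp only [hx] at h
      rw [abs_sub_comm] at h
      calc _ ≤ 1 * ε := mul_le_mul (Real.abs_sin_le_one _) h.le (abs_nonneg _) zero_le_one
        _ = ε := one_mul ε
    · exact integrable_mul_cont f (h := fun x => ((Real.sin (Real.pi * x) * ψ x : ℝ) : ℂ))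
        (by fun_prop)
    · exact integrable_mul_cont f (h := fun x => ((Real.sin (Real.pi * x) *
        p.eval (Real.cos (Real.pi * x)) : ℝ) : ℂ)) (by fun_prop)
  rw [← norm_le_zero_iff]
  refine le_of_forall_pos_le_add fun ε hε => ?_
  refine (key (ε / (N + 1)) (by positivity)).trans ?_
  rw [zero_add, mul_div_assoc', div_le_iff₀ (by positivity)]
  nlinarith

/-- The eigenfunctions are complete. By uniqueness of the weak derivative of `0`, it suffices to test
`f(x) sin (π x)` against test functions. -/
theorem eq_zero_of_inner_eig_eq_zero {f : L2I} (hf : ∀ n, inner ℂ (eig n) f = 0) : f = 0 := by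
  have hmem : MemLp (fun x : I => f x * ((Real.sin (Real.pi * x) : ℝ) : ℂ)) 2 lebI := by
    refine (Lp.memLp f).mono ((Lp.memLp f).1.mul
      (Continuous.aestronglyMeasurable (by fun_prop))) (Eventually.of_forall fun x => ?_)
    rw [norm_mul, Complex.norm_real]
    exact mul_le_of_le_one_right (norm_nonneg _) (Real.abs_sin_le_one _)
  have h0 : hmem.toLp = 0 := by
    refine weakDerivGraph_functional (0, hmem.toLp) (fun φ hφ => ?_) rfl
    rw [integral_zero_mul_test, eq_comm, neg_eq_zero]
    have hre := integral_mul_sin_mul_cont_eq_zero hf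
      (Complex.continuous_re.comp hφ.1.continuous)
    have him := integral_mul_sin_mul_cont_eq_zero hf
      (Complex.continuous_im.comp hφ.1.continuous)
    have h : ∫ x : I, f x * ((Real.sin (Real.pi * x) * (φ x).re : ℝ) : ℂ) ∂lebI +
        Complex.I * ∫ x : I, f x * ((Real.sin (Real.pi * x) * (φ x).im : ℝ) : ℂ) ∂lebI = 0 := by
      simp only [Function.comp_apply] at hre him
      rw [hre, him, mul_zero, add_zero]
    rw [← integral_const_mul, ← integral_add] at h
    · rw [← h]
      refine integral_congr_ae ?_
      filter_upwards [hmem.coeFn_toLp] with x hx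
      simp only [hx]
      conv_lhs => rw [← Complex.re_add_im (φ x)]
      push_cast
      ring
    · exact integrable_mul_cont f (h := fun x => ((Real.sin (Real.pi * x) * (φ x).re : ℝ) : ℂ))
        (by have := hφ.1.continuous; fun_prop)
    · exact (integrable_mul_cont f
        (h := fun x => ((Real.sin (Real.pi * x) * (φ x).im : ℝ) : ℂ))
        (by have := hφ.1.continuous; fun_prop)).const_mul _
  refine Lp.ext ?_
  have h1 := hmem.coeFn_toLp
  rw [h0] at h1
  filter_upwards [h1, Lp.coeFn_zero ℂ 2 lebI] with x hx h2
  rw [h2] at hx ⊢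
  refine (mul_eq_zero.1 hx.symm).resolve_right ?_
  rw [Complex.ofReal_eq_zero, ← ne_eq]
  refine (Real.sin_pos_of_pos_of_lt_pi (mul_pos Real.pi_pos x.2.1) ?_).ne'
  exact mul_lt_of_lt_one_right Real.pi_pos x.2.2

/-- The eigenfunctions of the Dirichlet Laplacian form a Hilbert basis of `L²(0,1)`. -/
def eigBasis : HilbertBasis ℕ ℂ L2I :=
  HilbertBasis.mkOfOrthogonalEqBot orthonormal_eig (by
    rw [Submodule.eq_bot_iff]
    intro f hf
    exact eq_zero_of_inner_eig_eq_zero fun n =>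
      hf (eig n) (Submodule.subset_span (mem_range_self n)))

theorem coe_eigBasis : ⇑eigBasis = eig := HilbertBasis.coe_mkOfOrthogonalEqBot _ _

theorem hasSum_inner_eig (f : L2I) : HasSum (fun n => inner ℂ (eig n) f • eig n) f := by
  have h := eigBasis.hasSum_repr f
  simp only [HilbertBasis.repr_apply_apply, coe_eigBasis] at h
  exact h

/-- The Dirichlet Laplacian is diagonal in the eigenfunctions, with its maximal domain. -/
theorem mem_dirichletLaplacian_graph_iff_inner {u g : L2I} :
    (u, g) ∈ dirichletLaplacian.graph ↔
      ∀ n, inner ℂ (eig n) g = ((freq n ^ 2 : ℝ) : ℂ) * inner ℂ (eig n) u := by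
  refine ⟨inner_eig_of_mem_graph, fun h => ?_⟩
  have hs : HasSum (fun n => inner ℂ (eig n) u • (eig n, ((freq n ^ 2 : ℝ) : ℂ) • eig n))
      (u, g) := by
    refine HasSum.prodMk (hasSum_inner_eig u) ?_
    convert hasSum_inner_eig g using 2 with n
    rw [h n, mul_comm, mul_smul]
  refine isClosed_dirichletLaplacian_graph.mem_of_tendsto hs
    (Eventually.of_forall fun s => ?_)
  exact dirichletLaplacian.graph.sum_mem fun n _ =>
    dirichletLaplacian.graph.smul_mem _ (eig_mem_graph n)

/-! ### Diagonal semigroups on a Hilbert space -/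

section Diagonal

variable {ι H : Type*} [NormedAddCommGroup H] [InnerProductSpace ℂ H]

theorem hasSum_norm_inner_sq (b : HilbertBasis ι ℂ H) (f : H) :
    HasSum (fun i => ‖inner ℂ (b i) f‖ ^ 2) (‖f‖ ^ 2) := by
  have h := b.hasSum_inner_mul_inner f f
  rw [inner_self_eq_norm_sq_to_K] at h
  have e : ∀ i, inner ℂ f (b i) * inner ℂ (b i) f = ((‖inner ℂ (b i) f‖ ^ 2 : ℝ) : ℂ) := fun i => by
    rw [← inner_conj_symm, ← Complex.normSq_eq_conj_mul_self, Complex.normSq_eq_norm_sq]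
  simp only [e] at h
  rw [← Complex.hasSum_ofReal, Complex.ofReal_pow]
  exact h

theorem ext_inner_basis (b : HilbertBasis ι ℂ H) {f g : H}
    (h : ∀ i, inner ℂ (b i) f = inner ℂ (b i) g) : f = g := by
  refine b.repr.injective (lp.ext (funext fun i => ?_))
  rw [b.repr_apply_apply, b.repr_apply_apply, h i]

/-- A multiplier on the coefficients with values in the closed unit disc defines a bounded
operator. -/
theorem exists_diagonal (b : HilbertBasis ι ℂ H) (d : ι → ℂ) (hd : ∀ i, ‖d i‖ ≤ 1) :
    ∃ D : H →L[ℂ] H, ∀ f i, inner ℂ (b i) (D f) = d i * inner ℂ (b i) f := by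
  have hle : ∀ (f : H) i, ‖d i * inner ℂ (b i) f‖ ^ 2 ≤ ‖inner ℂ (b i) f‖ ^ 2 := fun f i => by
    rw [norm_mul]
    exact pow_le_pow_left₀ (by positivity)
      (mul_le_of_le_one_left (norm_nonneg _) (hd i)) 2
  have hmem : ∀ f : H, Memℓp (fun i => d i * inner ℂ (b i) f) 2 := fun f => by
    refine memℓp_gen ?_
    simp only [ENNReal.toReal_ofNat, Real.rpow_ofNat]
    exact Summable.of_nonneg_of_le (fun i => by positivity) (hle f)
      (hasSum_norm_inner_sq b f).summable
  let D₀ : H → H := fun f => b.repr.symm ⟨_, hmem f⟩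
  have hD₀ : ∀ f i, inner ℂ (b i) (D₀ f) = d i * inner ℂ (b i) f := fun f i => by
    rw [← b.repr_apply_apply]
    simp [D₀]
  let D₁ : H →ₗ[ℂ] H :=
    { toFun := D₀
      map_add' := fun f g => ext_inner_basis b fun i => by
        rw [inner_add_right, hD₀, hD₀, hD₀, inner_add_right, mul_add]
      map_smul' := fun c f => ext_inner_basis b fun i => by
        rw [RingHom.id_apply, inner_smul_right, hD₀, hD₀, inner_smul_right, mul_left_comm] }
  refine ⟨D₁.mkContinuous 1 fun f => ?_, fun f i => hD₀ f i⟩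
  rw [one_mul]
  refine le_of_sq_le_sq (hasSum_le (fun i => ?_) (hasSum_norm_inner_sq b (D₁ f))
    (hasSum_norm_inner_sq b f)) (norm_nonneg _)
  change ‖inner ℂ (b i) (D₀ f)‖ ^ 2 ≤ _
  rw [hD₀]
  exact hle f i

theorem exists_diagonal_semigroup (b : HilbertBasis ι ℂ H) (m : ι → ℂ) (hm : ∀ i, (m i).re ≤ 0) :
    ∃ S : ℝ → H →L[ℂ] H, ∀ t, 0 ≤ t → ∀ f i,
      inner ℂ (b i) (S t f) = Complex.exp (t * m i) * inner ℂ (b i) f := by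
  have h : ∀ t : ℝ, ∃ D : H →L[ℂ] H, 0 ≤ t → ∀ f i,
      inner ℂ (b i) (D f) = Complex.exp (t * m i) * inner ℂ (b i) f := by
    intro t
    by_cases ht : 0 ≤ t
    · obtain ⟨D, hD⟩ := exists_diagonal b (fun i => Complex.exp (t * m i)) fun i => by
        rw [Complex.norm_exp, Complex.re_ofReal_mul]
        exact Real.exp_le_one_iff.2 (mul_nonpos_of_nonneg_of_nonpos ht (hm i))
      exact ⟨D, fun _ => hD⟩
    · exact ⟨0, fun h => absurd h ht⟩
  choose S hS using h
  exact ⟨S, hS⟩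

/-- Convergence of uniformly bounded multipliers on each coefficient implies strong
convergence. -/
theorem tendsto_of_inner_eq_mul (b : HilbertBasis ι ℂ H) {l : Filter ℝ} {G : ℝ → H} {f : H}
    {d : ℝ → ι → ℂ} (hG : ∀ᶠ h in l, ∀ i, inner ℂ (b i) (G h) = d h i * inner ℂ (b i) f)
    (hd : ∀ᶠ h in l, ∀ i, ‖d h i‖ ≤ 1) (hlim : ∀ i, Tendsto (fun h => d h i) l (𝓝 1)) :
    Tendsto G l (𝓝 f) := by
  rw [tendsto_iff_norm_sub_tendsto_zero]
  have hsq : Tendsto (fun h => ∑' i, ‖(d h i - 1) * inner ℂ (b i) f‖ ^ 2) l (𝓝 0) := by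
    have h := tendsto_tsum_of_dominated_convergence (𝓕 := l)
      (f := fun h i => ‖(d h i - 1) * inner ℂ (b i) f‖ ^ 2) (g := fun _ => (0 : ℝ))
      (bound := fun i => 2 ^ 2 * ‖inner ℂ (b i) f‖ ^ 2)
      ((hasSum_norm_inner_sq b f).summable.mul_left _) (fun i => ?_) ?_
    · simpa using h
    · have h1 := (((hlim i).sub_const 1).mul_const (inner ℂ (b i) f)).norm.pow 2
      simpa using h1
    · filter_upwards [hd] with h hh i
      rw [norm_pow, norm_norm, norm_mul, mul_pow]
      refine mul_le_mul_of_nonneg_right (pow_le_pow_left₀ (norm_nonneg _) ?_ 2) (by positivity)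
      refine (norm_sub_le _ _).trans ?_
      rw [norm_one]
      linarith [hh i]
  have h2 : Tendsto (fun h => ‖G h - f‖ ^ 2) l (𝓝 0) := by
    refine hsq.congr' ?_
    filter_upwards [hG] with h hh
    rw [← (hasSum_norm_inner_sq b (G h - f)).tsum_eq]
    refine tsum_congr fun i => ?_
    rw [inner_sub_right, hh, sub_mul, one_mul]
  have h3 := h2.sqrt
  simpa [Real.sqrt_sq] using h3

theorem norm_exp_sub_one_le_of_re_nonpos {z : ℂ} (hz : z.re ≤ 0) : ‖Complex.exp z - 1‖ ≤ ‖z‖ := by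
  have h := Convex.norm_image_sub_le_of_norm_hasDerivWithin_le (𝕜 := ℂ) (s := {w : ℂ | w.re ≤ 0})
    (C := 1) (fun w _ => (Complex.hasDerivAt_exp w).hasDerivWithinAt) (fun w hw => ?_)
    (convex_halfSpace_re_le 0) (x := 0) (y := z) (by simp) hz
  · simpa using h
  · rw [Complex.norm_exp]
    exact Real.exp_le_one_iff.2 hw

variable {b : HilbertBasis ι ℂ H} {m : ι → ℂ} {S : ℝ → H →L[ℂ] H}

theorem diagonal_semigroup_isC0Semigroup (hm : ∀ i, (m i).re ≤ 0)
    (hS : ∀ t, 0 ≤ t → ∀ f i, inner ℂ (b i) (S t f) = Complex.exp (t * m i) * inner ℂ (b i) f) :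
    IsC0Semigroup S where
  map_zero := by
    ext f
    refine ext_inner_basis b fun i => ?_
    rw [hS 0 le_rfl]
    simp
  map_add s t hs ht := by
    ext f
    refine ext_inner_basis b fun i => ?_
    rw [hS _ (add_nonneg hs ht), ContinuousLinearMap.comp_apply, hS _ hs, hS _ ht, ← mul_assoc,
      ← Complex.exp_add]
    push_cast
    rw [add_mul]
  tendsto_zero f := by
    refine tendsto_of_inner_eq_mul b (d := fun t i => Complex.exp (t * m i)) ?_ ?_ fun i => ?_
    · filter_upwards [self_mem_nhdsWithin] with t ht using hS t (le_of_lt ht) f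
    · filter_upwards [self_mem_nhdsWithin] with t ht i
      rw [Complex.norm_exp, Complex.re_ofReal_mul]
      exact Real.exp_le_one_iff.2 (mul_nonpos_of_nonneg_of_nonpos (le_of_lt ht) (hm i))
    · have h : Continuous fun t : ℝ => Complex.exp (t * m i) := by fun_prop
      have h1 := (h.tendsto 0).mono_left (nhdsWithin_le_nhds (s := Ioi 0))
      simpa using h1

theorem tendsto_exp_sub_one_div (c : ℂ) :
    Tendsto (fun h : ℝ => ((h⁻¹ : ℝ) : ℂ) * (Complex.exp (h * c) - 1)) (𝓝[>] 0) (𝓝 c) := by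
  have h1 : HasDerivAt (fun t : ℝ => Complex.exp (t * c)) c 0 := by
    have h2 := ((Complex.ofRealCLM.hasDerivAt (x := (0 : ℝ))).mul_const c).cexp
    simpa using h2
  have h3 := h1.tendsto_slope_zero_right
  simpa using h3

/-- The generator of a diagonal semigroup is the diagonal operator with its maximal domain. -/
theorem diagonal_semigroup_tendsto_iff (hm : ∀ i, (m i).re ≤ 0) (hm0 : ∀ i, m i ≠ 0)
    (hS : ∀ t, 0 ≤ t → ∀ f i, inner ℂ (b i) (S t f) = Complex.exp (t * m i) * inner ℂ (b i) f)
    {f g : H} :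
    Tendsto (fun h : ℝ => ((h⁻¹ : ℝ) : ℂ) • (S h f - f)) (𝓝[>] 0) (𝓝 g) ↔
      ∀ i, inner ℂ (b i) g = m i * inner ℂ (b i) f := by
  have hcoef : ∀ h : ℝ, 0 < h → ∀ i, inner ℂ (b i) (((h⁻¹ : ℝ) : ℂ) • (S h f - f)) =
      ((h⁻¹ : ℝ) : ℂ) * (Complex.exp (h * m i) - 1) * inner ℂ (b i) f := by
    intro h hh i
    rw [inner_smul_right, inner_sub_right, hS h hh.le]
    ring
  constructor
  · intro hlim i
    have h1 : Tendsto (fun h : ℝ => inner ℂ (b i) (((h⁻¹ : ℝ) : ℂ) • (S h f - f))) (𝓝[>] 0)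
        (𝓝 (inner ℂ (b i) g)) := tendsto_const_nhds.inner hlim
    refine tendsto_nhds_unique h1 (((tendsto_exp_sub_one_div (m i)).mul_const _).congr' ?_)
    filter_upwards [self_mem_nhdsWithin] with h hh using (hcoef h hh i).symm
  · intro hg
    -- The difference quotient is a multiplier applied to `g = A f`, bounded by `1`.
    refine tendsto_of_inner_eq_mul b
      (d := fun h i => ((h⁻¹ : ℝ) : ℂ) * (Complex.exp (h * m i) - 1) / m i) ?_ ?_ fun i => ?_
    · filter_upwards [self_mem_nhdsWithin] with h hh i
      rw [hcoef h hh, hg i]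
      field_simp [hm0 i]
    · filter_upwards [self_mem_nhdsWithin] with h hh i
      have hh : 0 < h := hh
      have h1 := norm_exp_sub_one_le_of_re_nonpos (z := h * m i) (by
        rw [Complex.re_ofReal_mul]
        exact mul_nonpos_of_nonneg_of_nonpos hh.le (hm i))
      rw [norm_mul, Complex.norm_real, Real.norm_eq_abs, abs_of_pos hh] at h1
      rw [norm_div, norm_mul, Complex.norm_real, Real.norm_eq_abs, abs_of_pos (inv_pos.2 hh),
        div_le_one (norm_pos_iff.2 (hm0 i)), inv_mul_le_iff₀ hh]
      exact h1
    · have h1 := (tendsto_exp_sub_one_div (m i)).div_const (m i)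
      rwa [div_self (hm0 i)] at h1

end Diagonal

/-! ### Strongly continuous semigroups on eigenvectors of the generator -/

section Eigenvector

variable {E : Type*} [NormedAddCommGroup E] [NormedSpace ℂ E] {T : ℝ → E →L[ℂ] E}

theorem IsC0Semigroup.tendsto_Ici (hT : IsC0Semigroup T) (f : E) :
    Tendsto (fun t => T t f) (𝓝[≥] 0) (𝓝 f) := by
  have h : ContinuousWithinAt (fun t => T t f) (Ioi 0) 0 := by
    change Tendsto _ _ (𝓝 (T 0 f))
    rw [hT.map_zero]
    exact hT.tendsto_zero f
  have h2 := continuousWithinAt_Ioi_iff_Ici.1 h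
  change Tendsto _ _ (𝓝 (T 0 f)) at h2
  rwa [hT.map_zero] at h2

/-- A strongly continuous semigroup is bounded near `0`, by the Banach–Steinhaus theorem. -/
theorem IsC0Semigroup.exists_bound_near_zero [CompleteSpace E] (hT : IsC0Semigroup T) :
    ∃ δ > 0, ∃ M, 1 ≤ M ∧ ∀ t ∈ Icc 0 δ, ‖T t‖ ≤ M := by
  by_contra! hcon
  have h : ∀ n : ℕ, ∃ t ∈ Icc (0 : ℝ) (1 / (n + 1)), (n : ℝ) + 1 < ‖T t‖ := fun n =>
    hcon (1 / (n + 1)) (by positivity) (n + 1) (by simp)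
  choose s hs hs' using h
  have hs0 : Tendsto s atTop (𝓝[≥] 0) :=
    tendsto_nhdsWithin_iff.2 ⟨squeeze_zero (fun n => (hs n).1) (fun n => (hs n).2)
      tendsto_one_div_add_atTop_nhds_zero_nat, Eventually.of_forall fun n => (hs n).1⟩
  obtain ⟨C, hC⟩ := banach_steinhaus (g := fun n => T (s n)) fun f => by
    obtain ⟨B, hB⟩ := (((hT.tendsto_Ici f).comp hs0).norm).bddAbove_range
    exact ⟨B, fun n => hB (mem_range_self n)⟩
  obtain ⟨n, hn⟩ := exists_nat_gt C
  linarith [hC n, hs' n]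

theorem IsC0Semigroup.exists_bound [CompleteSpace E] (hT : IsC0Semigroup T) (a : ℝ) :
    ∃ B, ∀ t ∈ Icc 0 a, ‖T t‖ ≤ B := by
  obtain ⟨δ, hδ, M, hM, hb⟩ := hT.exists_bound_near_zero
  have h : ∀ n : ℕ, ∀ t ∈ Icc 0 ((n + 1) * δ), ‖T t‖ ≤ M ^ (n + 1) := by
    intro n
    induction n with
    | zero => simpa using hb
    | succ n ih =>
      intro t ht
      push_cast at ht
      by_cases h : t ≤ (n + 1) * δ
      · exact (ih t ⟨ht.1, h⟩).trans (pow_le_pow_right₀ hM (by omega))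
      · have h0 : 0 ≤ (n + 1 : ℝ) * δ := by positivity
        have h1 : t = δ + (t - δ) := by ring
        have h2 : 0 ≤ t - δ := by
          have : 0 ≤ (n : ℝ) * δ := by positivity
          linarith
        rw [h1, hT.map_add δ (t - δ) hδ.le h2, pow_succ' M]
        refine (ContinuousLinearMap.opNorm_comp_le _ _).trans (mul_le_mul (hb δ ⟨hδ.le, le_rfl⟩)
          (ih _ ⟨h2, ?_⟩) (norm_nonneg _) (zero_le_one.trans hM))
        have := ht.2
        linarith
  obtain ⟨n, hn⟩ := exists_nat_gt (a / δ)
  refine ⟨M ^ (n + 1), fun t ht => h n t ⟨ht.1, ht.2.trans ?_⟩⟩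
  rw [div_lt_iff₀ hδ] at hn
  nlinarith

/-- The orbits of a strongly continuous semigroup are continuous; the local bound is what gives
continuity from the left. -/
theorem IsC0Semigroup.continuousOn [CompleteSpace E] (hT : IsC0Semigroup T) (f : E) (a : ℝ) :
    ContinuousOn (fun t => T t f) (Icc 0 a) := by
  obtain ⟨B, hB⟩ := hT.exists_bound a
  intro t ht
  have hle : ∀ s ∈ Icc 0 a, ‖T s f - T t f‖ ≤ B * ‖T |s - t| f - f‖ := by
    have key : ∀ r ∈ Icc 0 a, ∀ s ∈ Icc 0 a, r ≤ s → ‖T s f - T r f‖ ≤ B * ‖T (s - r) f - f‖ := by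
      intro r hr s hs hrs
      have h1 : T s f - T r f = T r (T (s - r) f - f) := by
        rw [map_sub, ← ContinuousLinearMap.comp_apply, ← hT.map_add _ _ hr.1 (sub_nonneg.2 hrs),
          add_sub_cancel]
      rw [h1]
      exact ((T r).le_opNorm _).trans (mul_le_mul_of_nonneg_right (hB r hr) (norm_nonneg _))
    intro s hs
    rcases le_total t s with h | h
    · rw [abs_of_nonneg (sub_nonneg.2 h)]
      exact key t ht s hs h
    · rw [abs_of_nonpos (sub_nonpos.2 h), neg_sub, norm_sub_rev]
      exact key s hs t ht h
  have hlim : Tendsto (fun s => |s - t|) (𝓝[Icc 0 a] t) (𝓝[≥] 0) := by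
    refine tendsto_nhdsWithin_iff.2 ⟨?_, Eventually.of_forall fun s => abs_nonneg (s - t)⟩
    have h : Continuous fun s => |s - t| := by fun_prop
    have h1 := (h.tendsto t).mono_left (nhdsWithin_le_nhds (s := Icc 0 a))
    simpa using h1
  have h2 := (tendsto_iff_norm_sub_tendsto_zero.1 ((hT.tendsto_Ici f).comp hlim)).const_mul B
  rw [mul_zero] at h2
  refine tendsto_iff_norm_sub_tendsto_zero.2 (squeeze_zero' ?_ ?_ h2)
  · exact Eventually.of_forall fun _ => norm_nonneg _
  · filter_upwards [self_mem_nhdsWithin] with s hs using hle s hs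

theorem IsC0Semigroup.hasDerivWithinAt (hT : IsC0Semigroup T) {f g : E}
    (h : Tendsto (fun h : ℝ => ((h⁻¹ : ℝ) : ℂ) • (T h f - f)) (𝓝[>] 0) (𝓝 g)) {t : ℝ}
    (ht : 0 ≤ t) : HasDerivWithinAt (fun t => T t f) (T t g) (Ici t) t := by
  rw [hasDerivWithinAt_iff_tendsto_slope, Ici_sdiff_left]
  have hlim : Tendsto (fun s => s - t) (𝓝[>] t) (𝓝[>] 0) := by
    refine tendsto_nhdsWithin_iff.2 ⟨?_, ?_⟩
    · have h : Continuous fun s => s - t := by fun_prop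
      have h1 := (h.tendsto t).mono_left (nhdsWithin_le_nhds (s := Ioi t))
      simpa using h1
    · filter_upwards [self_mem_nhdsWithin] with s hs using mem_Ioi.2 (sub_pos.2 (mem_Ioi.1 hs))
  refine ((((T t).continuous.tendsto g).comp h).comp hlim).congr' ?_
  filter_upwards [self_mem_nhdsWithin] with s hs
  have hs : t < s := hs
  have h1 : T s f = T t (T (s - t) f) := by
    rw [← ContinuousLinearMap.comp_apply, ← hT.map_add _ _ ht (sub_nonneg.2 hs.le),
      add_sub_cancel]
  rw [slope_def_module, h1, ← map_sub, Function.comp_apply, Function.comp_apply, map_smul,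
    Complex.coe_smul]

/-- A semigroup acts on an eigenvector of its generator by the exponential of the eigenvalue. -/
theorem IsSemigroupGeneratedBy.apply_eigenvector [CompleteSpace E] {A : E →ₗ.[ℂ] E}
    (hT : IsSemigroupGeneratedBy A T) {f : E} {c : ℂ} (hf : (f, c • f) ∈ A.graph) {t : ℝ}
    (ht : 0 ≤ t) : T t f = Complex.exp (t * c) • f := by
  have h0 := hT.isC0Semigroup
  have hlim := (hT.mem_graph_iff _ _).1 hf
  have hexp : ∀ s : ℝ, HasDerivAt (fun s : ℝ => Complex.exp (-(s * c)))
      (Complex.exp (-(s * c)) * -c) s := fun s => by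
    have h2 := ((Complex.ofRealCLM.hasDerivAt (x := s)).mul_const c).neg.cexp
    simpa using h2
  have hcont : ContinuousOn (fun s : ℝ => Complex.exp (-(s * c)) • T s f) (Icc 0 t) :=
    (Continuous.continuousOn (by fun_prop)).smul (h0.continuousOn f t)
  have hder : ∀ s ∈ Ico 0 t,
      HasDerivWithinAt (fun s : ℝ => Complex.exp (-(s * c)) • T s f) 0 (Ici s) s := by
    intro s hs
    refine ((hexp s).hasDerivWithinAt.smul (h0.hasDerivWithinAt hlim hs.1)).congr_deriv ?_
    rw [map_smul, smul_smul, ← add_smul]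
    simp
  -- The function `s ↦ exp (-s c) • T s f` has right derivative `0`, hence is constant.
  have h := constant_of_has_deriv_right_zero hcont hder t ⟨ht, le_rfl⟩
  simp only [h0.map_zero, Complex.ofReal_zero, zero_mul, neg_zero, Complex.exp_zero, one_smul,
    ContinuousLinearMap.id_apply] at h
  rw [← h, smul_smul, ← Complex.exp_add]
  simp [h]

end Eigenvector

/-! ### Functions on the disjoint union of two intervals -/

section Glue

variable {X : Type*} [MeasurableSpace X] {μ : Measure X}

theorem integral_sumMeasure {E : Type*} [NormedAddCommGroup E] [NormedSpace ℝ E] {F : X ⊕ X → E}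
    (hF : Integrable F (sumMeasure μ)) :
    ∫ z, F z ∂(sumMeasure μ) = ∫ x, F (Sum.inl x) ∂μ + ∫ x, F (Sum.inr x) ∂μ := by
  rw [sumMeasure, integral_add_measure (hF.mono_measure (Measure.le_add_right le_rfl))
    (hF.mono_measure (Measure.le_add_left le_rfl)), measurableEmbedding_inl.integral_map,
    measurableEmbedding_inr.integral_map]

theorem coeFn_glue (w : Lp ℂ 2 μ × Lp ℂ 2 μ) :
    ∀ᵐ z ∂(sumMeasure μ), glue w z = Sum.elim w.1 w.2 z :=
  MemLp.coeFn_toLp (memLp_sumElim (Lp.memLp w.1) (Lp.memLp w.2))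

theorem norm_glue_sq (w : Lp ℂ 2 μ × Lp ℂ 2 μ) : ‖glue w‖ ^ 2 = ‖w.1‖ ^ 2 + ‖w.2‖ ^ 2 := by
  have hi : Integrable (fun z => ‖glue w z‖ ^ 2) (sumMeasure μ) :=
    (memLp_two_iff_integrable_sq_norm (Lp.memLp _).1).1 (Lp.memLp _)
  have h := ae_sumMeasure.1 (coeFn_glue w)
  rw [norm_sq_eq_integral, norm_sq_eq_integral, norm_sq_eq_integral, integral_sumMeasure hi]
  congr 1
  · refine integral_congr_ae ?_
    filter_upwards [h.1] with x hx
    rw [hx, Sum.elim_inl]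
  · refine integral_congr_ae ?_
    filter_upwards [h.2] with x hx
    rw [hx, Sum.elim_inr]

theorem norm_glue_le (w : Lp ℂ 2 μ × Lp ℂ 2 μ) : ‖glue w‖ ≤ ‖w.1‖ + ‖w.2‖ := by
  refine le_of_sq_le_sq ?_ (by positivity)
  rw [norm_glue_sq]
  have := mul_nonneg (norm_nonneg w.1) (norm_nonneg w.2)
  nlinarith

/-- The identification `glue` is a homeomorphism. -/
def glueCLE : (Lp ℂ 2 μ × Lp ℂ 2 μ) ≃L[ℂ] Lp ℂ 2 (sumMeasure μ) :=
  glue.toContinuousLinearEquivOfBounds 2 1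
    (fun w => (norm_glue_le w).trans (by linarith [norm_fst_le w, norm_snd_le w]))
    (fun F => by
      have h := norm_glue_sq (glue.symm F)
      rw [LinearEquiv.apply_symm_apply] at h
      rw [one_mul, Prod.norm_def]
      refine max_le ?_ ?_
      · exact le_of_sq_le_sq (by nlinarith [sq_nonneg ‖(glue.symm F).2‖]) (norm_nonneg _)
      · exact le_of_sq_le_sq (by nlinarith [sq_nonneg ‖(glue.symm F).1‖]) (norm_nonneg _))

end Glue

/-- The index of the copy of `(0,1)` that contains a point of `𝕏`. -/
def side : 𝕏 → Fin 2 := Sum.elim (fun _ => 0) (fun _ => 1)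

/-- The coordinate in `(0,1)` of a point of `𝕏`. -/
def pt : 𝕏 → ℝ := Sum.elim Subtype.val Subtype.val

/-- The function `c ⊗ eₙ` on `𝕏`, equal to `c i • eₙ` on the `i`-th copy of `(0,1)`. -/
def mode (n : ℕ) : (Fin 2 → ℂ) →ₗ[ℂ] L2𝕏 where
  toFun c := glue (c 0 • eig n, c 1 • eig n)
  map_add' c d := by
    rw [← map_add, Prod.mk_add_mk, Pi.add_apply, Pi.add_apply, add_smul, add_smul]
  map_smul' a c := by
    rw [RingHom.id_apply, ← map_smul, Prod.smul_mk, Pi.smul_apply, Pi.smul_apply, smul_assoc,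
      smul_assoc]

theorem mode_apply (n : ℕ) (c : Fin 2 → ℂ) : mode n c = glue (c 0 • eig n, c 1 • eig n) := rfl

theorem coeFn_mode (n : ℕ) (c : Fin 2 → ℂ) :
    ∀ᵐ z ∂leb𝕏, mode n c z = c (side z) * (eigfun n (pt z) : ℂ) := by
  have h := ae_sumMeasure.1 (coeFn_glue (c 0 • eig n, c 1 • eig n))
  refine ae_sumMeasure.2 ⟨?_, ?_⟩
  · filter_upwards [h.1, Lp.coeFn_smul (c 0) (eig n), coeFn_eig n] with x h1 h2 h3
    rw [mode_apply, h1, Sum.elim_inl, h2, Pi.smul_apply, h3]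
    rfl
  · filter_upwards [h.2, Lp.coeFn_smul (c 1) (eig n), coeFn_eig n] with x h1 h2 h3
    rw [mode_apply, h1, Sum.elim_inr, h2, Pi.smul_apply, h3]
    rfl

theorem norm_mode_le (n : ℕ) (c : Fin 2 → ℂ) : ‖mode n c‖ ≤ ‖c 0‖ + ‖c 1‖ := by
  refine (norm_glue_le _).trans ?_
  rw [norm_smul, norm_smul, orthonormal_eig.1 n, mul_one, mul_one]

/-- The coefficients of `F ∈ L²(𝕏)` with respect to the functions `eₙ` on the two copies. -/
def coef (n : ℕ) (F : L2𝕏) : Fin 2 → ℂ :=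
  ![inner ℂ (eig n) (glue.symm F).1, inner ℂ (eig n) (glue.symm F).2]

theorem continuous_coef (n : ℕ) : Continuous (coef n) := by
  have h : Continuous fun F : L2𝕏 => glue.symm F := glueCLE.symm.continuous
  refine continuous_pi fun i => ?_
  fin_cases i
  · exact continuous_const.inner h.fst
  · exact continuous_const.inner h.snd

/-- The eigenfunction expansion in `L²(𝕏)`. -/
theorem hasSum_mode_coef (F : L2𝕏) : HasSum (fun n => mode n (coef n F)) F := by
  have h := ((hasSum_inner_eig (glue.symm F).1).prodMk (hasSum_inner_eig (glue.symm F).2)).mapL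
    (glueCLE (μ := lebI)).toContinuousLinearMap
  have e : (glueCLE (μ := lebI)) ((glue.symm F).1, (glue.symm F).2) = F :=
    glue.apply_symm_apply F
  change HasSum _ ((glueCLE (μ := lebI)) ((glue.symm F).1, (glue.symm F).2)) at h
  rw [e] at h
  exact h

theorem memLp_conj {Y : Type*} [MeasurableSpace Y] {μ : Measure Y} (F : Lp ℂ 2 μ) :
    MemLp (fun y => starRingEnd ℂ (F y)) 2 μ :=
  (Lp.memLp F).star

/-- The bilinear pairing `∫ G F` as an inner product, which shows its continuity in `G`. -/
theorem inner_conj_toLp {Y : Type*} [MeasurableSpace Y] {μ : Measure Y} (F G : Lp ℂ 2 μ) :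
    inner ℂ (memLp_conj F).toLp G = ∫ y, G y * F y ∂μ := by
  rw [inner_toLp]
  simp only [Complex.conj_conj]

theorem integral_mode_mul (n : ℕ) (c : Fin 2 → ℂ) (F : L2𝕏) :
    ∫ z, mode n c z * F z ∂leb𝕏 = ∑ i, c i * coef n F i := by
  have hi : Integrable (fun z => mode n c z * F z) leb𝕏 :=
    (Lp.memLp (mode n c)).integrable_mul (Lp.memLp F)
  have h := ae_sumMeasure.1 (coeFn_mode n c)
  have hF := coeFn_glue (glue.symm F)
  rw [LinearEquiv.apply_symm_apply] at hF
  have hF := ae_sumMeasure.1 hF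
  have hcoef : ∀ g : L2I, inner ℂ (eig n) g = ∫ x : I, (eigfun n x : ℂ) * g x ∂lebI := fun g => by
    rw [eig, inner_ofCont]
    simp only [Complex.conj_ofReal, mul_comm]
  rw [integral_sumMeasure hi, Fin.sum_univ_two]
  simp only [coef, Matrix.cons_val_zero, Matrix.cons_val_one, hcoef]
  rw [← integral_const_mul, ← integral_const_mul]
  congr 1
  · refine integral_congr_ae ?_
    filter_upwards [h.1, hF.1] with x h1 h2
    rw [h1, h2, mul_assoc]
    rfl
  · refine integral_congr_ae ?_
    filter_upwards [h.2, hF.2] with x h1 h2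
    rw [h1, h2, mul_assoc]
    rfl

/-! ### The operator matrix in coefficients -/

/-- The graph of the operator matrix, in terms of the graph of the Dirichlet Laplacian. -/
theorem mem_waveOp_graph_iff {F G : L2𝕏} :
    (F, G) ∈ waveOp.graph ↔
      ((glue.symm F).2, (glue.symm G).1) ∈ dirichletLaplacian.graph ∧
      ((glue.symm F).1, -(glue.symm G).2 - (glue.symm G).1) ∈ dirichletLaplacian.graph := by
  obtain ⟨⟨u, v⟩, rfl⟩ := glue.surjective F
  obtain ⟨⟨a, b⟩, rfl⟩ := glue.surjective G
  simp only [LinearEquiv.symm_apply_apply]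
  have hdom : ∀ u v : L2I, glue (u, v) ∈ waveDomain ↔
      u ∈ dirichletLaplacian.domain ∧ v ∈ dirichletLaplacian.domain := fun u v => by
    change (glue.symm (glue (u, v))).1 ∈ _ ∧ (glue.symm (glue (u, v))).2 ∈ _ ↔ _
    rw [LinearEquiv.symm_apply_apply]
    rfl
  rw [LinearPMap.mem_graph_iff]
  constructor
  · rintro ⟨⟨y, hy⟩, hyF, hyG⟩
    obtain rfl : y = glue (u, v) := hyF
    obtain ⟨hu, hv⟩ := (hdom u v).1 hy
    have h := waveOp_glue ⟨u, hu⟩ ⟨v, hv⟩ hy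
    have h2 := glue.injective (h.symm.trans hyG)
    rw [Prod.mk_inj] at h2
    rw [← h2.1, ← h2.2]
    refine ⟨dirichletLaplacian.mem_graph ⟨v, hv⟩, ?_⟩
    have h3 := dirichletLaplacian.mem_graph ⟨u, hu⟩
    convert h3 using 2
    abel
  · rintro ⟨h1, h2⟩
    have hv := LinearPMap.mem_domain_of_mem_graph h1
    have hu := LinearPMap.mem_domain_of_mem_graph h2
    refine ⟨⟨glue (u, v), (hdom u v).2 ⟨hu, hv⟩⟩, rfl, ?_⟩
    have e1 : dirichletLaplacian ⟨v, hv⟩ = a :=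
      LinearPMap.mem_graph_snd_inj _ (dirichletLaplacian.mem_graph ⟨v, hv⟩) h1 rfl
    have e2 : dirichletLaplacian ⟨u, hu⟩ = -b - a :=
      LinearPMap.mem_graph_snd_inj _ (dirichletLaplacian.mem_graph ⟨u, hu⟩) h2 rfl
    refine (waveOp_glue ⟨u, hu⟩ ⟨v, hv⟩ _).trans ?_
    rw [e1, e2]
    congr 2
    abel

/-- The coefficient matrix of the operator matrix. -/
def coefMatrix : Matrix (Fin 2) (Fin 2) ℂ := !![0, 1; -1, -1]

theorem mem_waveOp_graph_iff_coef {F G : L2𝕏} :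
    (F, G) ∈ waveOp.graph ↔
      ∀ n, coef n G = ((freq n ^ 2 : ℝ) : ℂ) • coefMatrix.mulVec (coef n F) := by
  rw [mem_waveOp_graph_iff, mem_dirichletLaplacian_graph_iff_inner,
    mem_dirichletLaplacian_graph_iff_inner, ← forall_and]
  refine forall_congr' fun n => ?_
  rw [funext_iff, Fin.forall_fin_two]
  simp only [coef, coefMatrix, Pi.smul_apply, Matrix.mulVec, dotProduct, Fin.sum_univ_two,
    Matrix.cons_val_zero, Matrix.cons_val_one, Matrix.of_apply, inner_sub_right, inner_neg_right,
    smul_eq_mul]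
  constructor
  · rintro ⟨h1, h2⟩
    exact ⟨by linear_combination h1, by linear_combination -h1 - h2⟩
  · rintro ⟨h1, h2⟩
    exact ⟨by linear_combination h1, by linear_combination -h1 - h2⟩

theorem isClosed_waveOp_graph : IsClosed (waveOp.graph : Set (L2𝕏 × L2𝕏)) := by
  have e : (waveOp.graph : Set (L2𝕏 × L2𝕏)) =
      ⋂ n, {p | coef n p.2 = ((freq n ^ 2 : ℝ) : ℂ) • coefMatrix.mulVec (coef n p.1)} := by
    ext ⟨F, G⟩
    rw [SetLike.mem_coe, mem_waveOp_graph_iff_coef, mem_iInter]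
    rfl
  rw [e]
  refine isClosed_iInter fun n => isClosed_eq ((continuous_coef n).comp continuous_snd) ?_
  have h : Continuous fun p : L2𝕏 × L2𝕏 => coef n p.1 := (continuous_coef n).comp continuous_fst
  have h2 : Continuous fun p : L2𝕏 × L2𝕏 => coefMatrix.mulVec (coef n p.1) :=
    Continuous.matrix_mulVec continuous_const h
  exact h2.const_smul ((freq n ^ 2 : ℝ) : ℂ)

theorem mode_mem_graph (n : ℕ) (c : Fin 2 → ℂ) :
    (mode n c, ((freq n ^ 2 : ℝ) : ℂ) • mode n (coefMatrix.mulVec c)) ∈ waveOp.graph := by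
  rw [mem_waveOp_graph_iff, ← map_smul]
  simp only [mode_apply, LinearEquiv.symm_apply_apply]
  have h := eig_mem_graph n
  constructor
  · convert dirichletLaplacian.graph.smul_mem (c 1) h using 1
    simp only [coefMatrix, Prod.smul_mk, Pi.smul_apply, Matrix.mulVec, dotProduct,
      Fin.sum_univ_two, Matrix.cons_val_zero, Matrix.cons_val_one, Matrix.of_apply, smul_smul,
      smul_eq_mul]
    congr 2
    ring
  · convert dirichletLaplacian.graph.smul_mem (c 0) h using 1
    simp only [coefMatrix, Prod.smul_mk, Pi.smul_apply, Matrix.mulVec, dotProduct,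
      Fin.sum_univ_two, Matrix.cons_val_zero, Matrix.cons_val_one, Matrix.of_apply, smul_smul,
      smul_eq_mul, ← neg_smul, ← sub_smul]
    congr 2
    ring

/-! ### Spectral decomposition of the coefficient matrix -/

/-- A primitive cube root of unity. -/
def cubeRoot : ℂ := ⟨-1 / 2, √3 / 2⟩

/-- The eigenvalues of the coefficient matrix: the two primitive cube roots of unity. -/
def root : Fin 2 → ℂ := ![cubeRoot, starRingEnd ℂ cubeRoot]

theorem cubeRoot_quadratic : cubeRoot ^ 2 + cubeRoot + 1 = 0 := by
  have h : √3 * √3 = (3 : ℝ) := Real.mul_self_sqrt (by norm_num)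
  apply Complex.ext
  · simp [cubeRoot, sq]
    linarith
  · simp [cubeRoot, sq]
    ring

theorem root_quadratic (s : Fin 2) : root s ^ 2 + root s + 1 = 0 := by
  fin_cases s
  · exact cubeRoot_quadratic
  · have h := congrArg (starRingEnd ℂ) cubeRoot_quadratic
    simpa [root] using h

theorem root_re (s : Fin 2) : (root s).re = -1 / 2 := by
  fin_cases s <;> simp [root, cubeRoot]

theorem root_one_eq : root 1 = -1 - root 0 := by
  apply Complex.ext
  · rw [root_re, Complex.sub_re, root_re]
    norm_num
  · simp [root, cubeRoot]

theorem norm_root (s : Fin 2) : ‖root s‖ = 1 := by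
  have h : root s ^ 3 = 1 := by
    linear_combination (root s - 1) * root_quadratic s
  have h2 := congrArg norm h
  rw [norm_pow, norm_one] at h2
  exact (pow_eq_one_iff_of_nonneg (norm_nonneg _) (by norm_num)).1 h2

theorem root_ne_zero (s : Fin 2) : root s ≠ 0 := by
  rw [← norm_pos_iff, norm_root]
  exact one_pos

theorem one_le_norm_one_sub_root_sq (s : Fin 2) : 1 ≤ ‖1 - root s ^ 2‖ := by
  have h : 1 - root s ^ 2 = 2 + root s := by linear_combination -root_quadratic s
  rw [h]
  refine le_trans ?_ (Complex.re_le_norm _)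
  rw [Complex.add_re, root_re]
  norm_num

theorem one_sub_root_sq_ne_zero (s : Fin 2) : 1 - root s ^ 2 ≠ 0 := by
  rw [← norm_pos_iff]
  exact one_pos.trans_le (one_le_norm_one_sub_root_sq s)

/-- Right eigenvectors `(1, μ)` of the coefficient matrix. -/
def rightVec (s : Fin 2) : Fin 2 → ℂ := ![1, root s]

/-- Left eigenvectors `(1, -μ) / (1 - μ²)` of the coefficient matrix; together with the right
eigenvectors they form dual bases. -/
def leftVec (s : Fin 2) : Fin 2 → ℂ := ![(1 - root s ^ 2)⁻¹, -root s * (1 - root s ^ 2)⁻¹]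

theorem norm_rightVec (s i : Fin 2) : ‖rightVec s i‖ = 1 := by
  fin_cases i
  · simp [rightVec]
  · simp [rightVec, norm_root]

theorem norm_leftVec_le (s i : Fin 2) : ‖leftVec s i‖ ≤ 1 := by
  have h := inv_le_one_of_one_le₀ (one_le_norm_one_sub_root_sq s)
  fin_cases i
  · simpa [leftVec] using h
  · simpa [leftVec, norm_root] using h

theorem coefMatrix_mulVec_rightVec (s : Fin 2) :
    coefMatrix.mulVec (rightVec s) = root s • rightVec s := by
  ext i
  fin_cases i
  · simp [coefMatrix, rightVec, Matrix.mulVec, dotProduct, Fin.sum_univ_two]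
  · simp [coefMatrix, rightVec, Matrix.mulVec, dotProduct, Fin.sum_univ_two]
    linear_combination -root_quadratic s

theorem inv_add_inv_root :
    (1 - root 0 ^ 2)⁻¹ + (1 - root 1 ^ 2)⁻¹ = 1 := by
  have h0 := one_sub_root_sq_ne_zero 0
  have h1 := one_sub_root_sq_ne_zero 1
  field_simp
  rw [root_one_eq]
  linear_combination (-(root 0) ^ 2 - root 0 + 1) * root_quadratic 0

theorem root_inv_add_root_inv :
    root 0 * (1 - root 0 ^ 2)⁻¹ + root 1 * (1 - root 1 ^ 2)⁻¹ = 0 := by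
  have h0 := one_sub_root_sq_ne_zero 0
  have h1 := one_sub_root_sq_ne_zero 1
  field_simp
  rw [root_one_eq]
  linear_combination -root_quadratic 0

/-- The expansion of a vector in the basis of eigenvectors. -/
theorem sum_leftVec_smul_rightVec (c : Fin 2 → ℂ) :
    ∑ s, (leftVec s ⬝ᵥ c) • rightVec s = c := by
  have h0 := root_quadratic 0
  have h1 := root_quadratic 1
  have e1 := inv_add_inv_root
  have e2 := root_inv_add_root_inv
  ext i
  fin_cases i
  · simp [leftVec, rightVec, dotProduct, Fin.sum_univ_two]
    linear_combination c 0 * e1 - c 1 * e2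
  · simp [leftVec, rightVec, dotProduct, Fin.sum_univ_two]
    linear_combination c 0 * e2 + c 1 * e1 + c 1 * e2 - c 1 * (1 - root 0 ^ 2)⁻¹ * h0 -
      c 1 * (1 - root 1 ^ 2)⁻¹ * h1

/-! ### Existence of the semigroup -/

/-- The coordinates `(w₀, w₁)` of `F ∈ L²(𝕏)` with respect to the eigenvectors of the
coefficient matrix, `F = w₀ ⊗ (1, μ₀) + w₁ ⊗ (1, μ₁)`. -/
def eigenCoord : L2𝕏 ≃L[ℂ] L2I × L2I :=
  (glueCLE (μ := lebI)).symm.trans <| ContinuousLinearEquiv.equivOfInverse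
    ((leftVec 0 0 • ContinuousLinearMap.fst ℂ L2I L2I +
        leftVec 0 1 • ContinuousLinearMap.snd ℂ L2I L2I).prod
      (leftVec 1 0 • ContinuousLinearMap.fst ℂ L2I L2I +
        leftVec 1 1 • ContinuousLinearMap.snd ℂ L2I L2I))
    ((ContinuousLinearMap.fst ℂ L2I L2I + ContinuousLinearMap.snd ℂ L2I L2I).prod
      (root 0 • ContinuousLinearMap.fst ℂ L2I L2I + root 1 • ContinuousLinearMap.snd ℂ L2I L2I))
    (fun w => by
      have h0 := root_quadratic 0
      have h1 := root_quadratic 1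
      have e1 := inv_add_inv_root
      have e2 := root_inv_add_root_inv
      refine Prod.ext ?_ ?_
      · simp [leftVec]
        match_scalars
        · linear_combination e1
        · linear_combination -e2
      · simp [leftVec]
        match_scalars
        · linear_combination e2
        · linear_combination e1 + e2 - (1 - root 0 ^ 2)⁻¹ * h0 - (1 - root 1 ^ 2)⁻¹ * h1)
    (fun w => by
      have h0 := one_sub_root_sq_ne_zero 0
      have h1 := one_sub_root_sq_ne_zero 1
      refine Prod.ext ?_ ?_
      · simp [leftVec]
        match_scalars
        · field_simp
          ring
        · rw [root_one_eq]
          field_simp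
          linear_combination root_quadratic 0
      · simp [leftVec]
        match_scalars
        · field_simp
          rw [root_one_eq]
          linear_combination root_quadratic 0
        · field_simp
          ring)

theorem inner_eigenCoord_fst (n : ℕ) (F : L2𝕏) :
    inner ℂ (eig n) (eigenCoord F).1 = leftVec 0 ⬝ᵥ coef n F := by
  change inner ℂ (eig n) (leftVec 0 0 • (glue.symm F).1 + leftVec 0 1 • (glue.symm F).2) = _
  simp only [inner_add_right, inner_smul_right, coef, dotProduct, Fin.sum_univ_two,
    Matrix.cons_val_zero, Matrix.cons_val_one]

theorem inner_eigenCoord_snd (n : ℕ) (F : L2𝕏) :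
    inner ℂ (eig n) (eigenCoord F).2 = leftVec 1 ⬝ᵥ coef n F := by
  change inner ℂ (eig n) (leftVec 1 0 • (glue.symm F).1 + leftVec 1 1 • (glue.symm F).2) = _
  simp only [inner_add_right, inner_smul_right, coef, dotProduct, Fin.sum_univ_two,
    Matrix.cons_val_zero, Matrix.cons_val_one]

theorem leftVec_dotProduct_coefMatrix (s : Fin 2) (c : Fin 2 → ℂ) :
    leftVec s ⬝ᵥ coefMatrix.mulVec c = root s * leftVec s ⬝ᵥ c := by
  simp [leftVec, coefMatrix, dotProduct, Matrix.mulVec, Fin.sum_univ_two]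
  linear_combination c 1 * (1 - root s ^ 2)⁻¹ * root_quadratic s

/-- In eigenvector coordinates the operator matrix decouples. -/
theorem mem_waveOp_graph_iff_eigenCoord {F G : L2𝕏} :
    (F, G) ∈ waveOp.graph ↔
      (∀ n, inner ℂ (eig n) (eigenCoord G).1 =
        root 0 * ((freq n ^ 2 : ℝ) : ℂ) * inner ℂ (eig n) (eigenCoord F).1) ∧
      (∀ n, inner ℂ (eig n) (eigenCoord G).2 =
        root 1 * ((freq n ^ 2 : ℝ) : ℂ) * inner ℂ (eig n) (eigenCoord F).2) := by
  rw [mem_waveOp_graph_iff_coef, ← forall_and]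
  refine forall_congr' fun n => ?_
  simp only [inner_eigenCoord_fst, inner_eigenCoord_snd]
  constructor
  · intro h
    rw [h, dotProduct_smul, dotProduct_smul, leftVec_dotProduct_coefMatrix,
      leftVec_dotProduct_coefMatrix, smul_eq_mul, smul_eq_mul]
    constructor <;> ring
  · rintro ⟨h0, h1⟩
    rw [← sum_leftVec_smul_rightVec (coef n G),
      ← sum_leftVec_smul_rightVec (((freq n ^ 2 : ℝ) : ℂ) • coefMatrix.mulVec (coef n F))]
    refine Finset.sum_congr rfl fun s _ => ?_
    rw [dotProduct_smul, leftVec_dotProduct_coefMatrix, smul_eq_mul]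
    congr 1
    fin_cases s
    · change leftVec 0 ⬝ᵥ coef n G = _
      rw [h0]
      change _ = _ * (root 0 * leftVec 0 ⬝ᵥ coef n F)
      ring
    · change leftVec 1 ⬝ᵥ coef n G = _
      rw [h1]
      change _ = _ * (root 1 * leftVec 1 ⬝ᵥ coef n F)
      ring

/-- The semigroup is the direct sum, in eigenvector coordinates, of the two diagonal semigroups
with the eigenvalues `μ₀ λₙ` and `μ₁ λₙ`. -/
theorem exists_waveSemigroup : ∃ T : ℝ → L2𝕏 →L[ℂ] L2𝕏, IsSemigroupGeneratedBy waveOp T := by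
  have hm : ∀ s n, (root s * ((freq n ^ 2 : ℝ) : ℂ)).re ≤ 0 := fun s n => by
    rw [Complex.re_mul_ofReal, root_re]
    nlinarith [sq_nonneg (freq n)]
  have hm0 : ∀ s n, root s * ((freq n ^ 2 : ℝ) : ℂ) ≠ 0 := fun s n =>
    mul_ne_zero (root_ne_zero s) (Complex.ofReal_ne_zero.2 (pow_pos (freq_pos n) 2).ne')
  obtain ⟨S₀, hS₀⟩ := exists_diagonal_semigroup eigBasis _ (hm 0)
  obtain ⟨S₁, hS₁⟩ := exists_diagonal_semigroup eigBasis _ (hm 1)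
  have h0 := diagonal_semigroup_isC0Semigroup (hm 0) hS₀
  have h1 := diagonal_semigroup_isC0Semigroup (hm 1) hS₁
  let T : ℝ → L2𝕏 →L[ℂ] L2𝕏 := fun t => eigenCoord.symm.toContinuousLinearMap ∘L
    ((S₀ t).prodMap (S₁ t)) ∘L eigenCoord.toContinuousLinearMap
  have hT : ∀ t F, eigenCoord (T t F) = (S₀ t (eigenCoord F).1, S₁ t (eigenCoord F).2) :=
    fun t F => eigenCoord.apply_symm_apply _
  have hind : ∀ {f : ℝ → L2𝕏} {l : Filter ℝ} {G : L2𝕏}, Tendsto f l (𝓝 G) ↔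
      Tendsto (fun t => (eigenCoord (f t)).1) l (𝓝 (eigenCoord G).1) ∧
      Tendsto (fun t => (eigenCoord (f t)).2) l (𝓝 (eigenCoord G).2) := by
    intro f l G
    rw [eigenCoord.toHomeomorph.isInducing.tendsto_nhds_iff, Prod.tendsto_iff]
    rfl
  refine ⟨T, ⟨?_, ?_, fun F => ?_⟩, fun F G => ?_⟩
  · ext1 F
    apply eigenCoord.injective
    rw [hT, h0.map_zero, h1.map_zero]
    rfl
  · intro s t hs ht
    ext1 F
    apply eigenCoord.injective
    rw [hT, ContinuousLinearMap.comp_apply, hT, hT, h0.map_add s t hs ht, h1.map_add s t hs ht]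
    rfl
  · rw [hind]
    simp only [hT]
    exact ⟨h0.tendsto_zero _, h1.tendsto_zero _⟩
  · rw [mem_waveOp_graph_iff_eigenCoord, hind]
    simp only [map_smul, map_sub, hT]
    have e0 := diagonal_semigroup_tendsto_iff (hm 0) (hm0 0) hS₀ (f := (eigenCoord F).1)
      (g := (eigenCoord G).1)
    have e1 := diagonal_semigroup_tendsto_iff (hm 1) (hm0 1) hS₁ (f := (eigenCoord F).2)
      (g := (eigenCoord G).2)
    rw [coe_eigBasis] at e0 e1
    exact (and_congr e0 e1).symm

/-! ### The matrix exponential and its decay -/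

/-- The exponential `exp (τ M)` of the coefficient matrix `M`, in its spectral decomposition. -/
def expMatrix (τ : ℝ) : Matrix (Fin 2) (Fin 2) ℂ :=
  fun i j => ∑ s, Complex.exp (τ * root s) * rightVec s i * leftVec s j

theorem norm_expMatrix_le (τ : ℝ) (i j : Fin 2) : ‖expMatrix τ i j‖ ≤ 2 * Real.exp (-τ / 2) := by
  have h : ∀ s, ‖Complex.exp (τ * root s) * rightVec s i * leftVec s j‖ ≤ Real.exp (-τ / 2) := by
    intro s
    rw [norm_mul, norm_mul, norm_rightVec, mul_one, Complex.norm_exp, Complex.re_ofReal_mul,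
      root_re]
    refine (mul_le_of_le_one_right (Real.exp_nonneg _) (norm_leftVec_le s j)).trans_eq ?_
    congr 1
    ring
  refine (norm_sum_le_of_le _ fun s _ => h s).trans_eq ?_
  simp

theorem expMatrix_mulVec (τ : ℝ) (c : Fin 2 → ℂ) :
    (expMatrix τ).mulVec c =
      ∑ s, (leftVec s ⬝ᵥ c) • Complex.exp (τ * root s) • rightVec s := by
  ext i
  simp only [expMatrix, Matrix.mulVec, dotProduct, Fin.sum_univ_two, Pi.add_apply, Pi.smul_apply,
    smul_eq_mul]
  ring

/-- On the `n`-th eigenspace every semigroup generated by the operator matrix acts through the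
exponential of the coefficient matrix. -/
theorem waveSemigroup_mode {T : ℝ → L2𝕏 →L[ℂ] L2𝕏} (hT : IsSemigroupGeneratedBy waveOp T) {t : ℝ}
    (ht : 0 ≤ t) (n : ℕ) (c : Fin 2 → ℂ) :
    T t (mode n c) = mode n ((expMatrix (t * freq n ^ 2)).mulVec c) := by
  have h : ∀ s, T t (mode n (rightVec s)) =
      Complex.exp ((t * freq n ^ 2 : ℝ) * root s) • mode n (rightVec s) := by
    intro s
    have h1 := mode_mem_graph n (rightVec s)
    rw [coefMatrix_mulVec_rightVec, map_smul, smul_smul] at h1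
    rw [hT.apply_eigenvector h1 ht]
    congr 2
    push_cast
    ring
  conv_lhs => rw [← sum_leftVec_smul_rightVec c]
  rw [expMatrix_mulVec]
  simp only [map_sum, map_smul, h]

/-- The majorant `freq n ^ 3 * exp (-t λₙ / 2)` of all series below. -/
def majorant (t : ℝ) (n : ℕ) : ℝ := freq n ^ 3 * Real.exp (-(t * freq n ^ 2) / 2)

/-- The telescoping bound behind the estimate of the majorant: `4 y³ / (1 + t y²)³` is the derivative
of `(y² / (1 + t y²))²`, which is bounded by `1 / t²`. -/
theorem cube_div_le_sub {t : ℝ} (ht : 0 < t) {x : ℝ} (hx0 : 0 ≤ x) :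
    (x + 1) ^ 3 / (1 + t * (x + 1) ^ 2) ^ 3 ≤
      ((x + 1) ^ 2 / (1 + t * (x + 1) ^ 2)) ^ 2 - (x ^ 2 / (1 + t * x ^ 2)) ^ 2 := by
  have hA : 0 < 1 + t * (x + 1) ^ 2 := by positivity
  have hB : 0 < 1 + t * x ^ 2 := by positivity
  have hBA : 1 + t * x ^ 2 ≤ 1 + t * (x + 1) ^ 2 := by
    have : x ^ 2 ≤ (x + 1) ^ 2 := by nlinarith
    nlinarith
  have h1 : (x + 1) / (1 + t * (x + 1) ^ 2) ^ 2 ≤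
      (x + 1) ^ 2 / (1 + t * (x + 1) ^ 2) - x ^ 2 / (1 + t * x ^ 2) := by
    have e : (x + 1) ^ 2 / (1 + t * (x + 1) ^ 2) - x ^ 2 / (1 + t * x ^ 2) =
        (2 * x + 1) / ((1 + t * (x + 1) ^ 2) * (1 + t * x ^ 2)) := by
      field_simp
      ring
    rw [e, sq (1 + t * (x + 1) ^ 2)]
    exact div_le_div₀ (by positivity) (by linarith) (by positivity)
      (mul_le_mul_of_nonneg_left hBA hA.le)
  have h2 : (x + 1) ^ 2 / (1 + t * (x + 1) ^ 2) ≤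
      (x + 1) ^ 2 / (1 + t * (x + 1) ^ 2) + x ^ 2 / (1 + t * x ^ 2) :=
    le_add_of_nonneg_right (by positivity)
  have h3 := mul_le_mul h1 h2 (by positivity) ((by positivity : (0 : ℝ) ≤ _).trans h1)
  have e1 : (x + 1) / (1 + t * (x + 1) ^ 2) ^ 2 * ((x + 1) ^ 2 / (1 + t * (x + 1) ^ 2)) =
      (x + 1) ^ 3 / (1 + t * (x + 1) ^ 2) ^ 3 := by
    rw [div_mul_div_comm]
    ring
  rw [e1] at h3
  linarith

theorem majorant_le {t : ℝ} (ht : 0 < t) (n : ℕ) :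
    majorant t n ≤ Real.pi ^ 3 * (((n : ℝ) + 1) ^ 3 / (1 + t * ((n : ℝ) + 1) ^ 2) ^ 3) := by
  have hn : (0 : ℝ) < n + 1 := by positivity
  have hexp : (1 + t * ((n : ℝ) + 1) ^ 2) ^ 3 ≤ Real.exp (t * freq n ^ 2 / 2) := by
    -- The bound `(1 + y / 3) ^ 3 ≤ exp y`, with `π² ≥ 6`.
    have e : t * freq n ^ 2 / 2 = ((3 : ℕ) : ℝ) * (t * freq n ^ 2 / 6) := by
      push_cast
      ring
    rw [e, Real.exp_nat_mul]
    refine pow_le_pow_left₀ (by positivity) ?_ 3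
    refine le_trans ?_ (Real.add_one_le_exp _)
    have hpi : 6 ≤ Real.pi ^ 2 := by nlinarith [Real.pi_gt_three]
    have : t * ((n : ℝ) + 1) ^ 2 * 6 ≤ t * ((n : ℝ) + 1) ^ 2 * Real.pi ^ 2 :=
      mul_le_mul_of_nonneg_left hpi (by positivity)
    rw [freq, mul_pow]
    linarith
  rw [majorant, neg_div, Real.exp_neg, ← div_eq_mul_inv, freq, mul_pow, mul_comm, mul_div_assoc]
  exact mul_le_mul_of_nonneg_left
    (div_le_div_of_nonneg_left (by positivity) (by positivity) hexp) (by positivity)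

theorem majorant_nonneg (t : ℝ) (n : ℕ) : 0 ≤ majorant t n :=
  mul_nonneg (pow_nonneg (freq_pos n).le 3) (Real.exp_nonneg _)

theorem sum_range_majorant_le {t : ℝ} (ht : 0 < t) (N : ℕ) :
    ∑ n ∈ Finset.range N, majorant t n ≤ Real.pi ^ 3 * (t ^ 2)⁻¹ := by
  have h : ∑ n ∈ Finset.range N, majorant t n ≤
      Real.pi ^ 3 * ((N : ℝ) ^ 2 / (1 + t * (N : ℝ) ^ 2)) ^ 2 := by
    induction N with
    | zero => simp
    | succ N ih =>
      rw [Finset.sum_range_succ]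
      have h1 := (majorant_le ht N).trans (mul_le_mul_of_nonneg_left
        (cube_div_le_sub ht (Nat.cast_nonneg N)) (pow_nonneg Real.pi_pos.le 3))
      push_cast
      linarith
  refine h.trans (mul_le_mul_of_nonneg_left ?_ (pow_nonneg Real.pi_pos.le 3))
  rw [← inv_pow]
  refine pow_le_pow_left₀ (by positivity) ?_ 2
  rw [div_le_iff₀ (by positivity), inv_mul_eq_div, le_div_iff₀ ht]
  linarith

theorem summable_majorant {t : ℝ} (ht : 0 < t) : Summable (majorant t) :=
  summable_of_sum_range_le (majorant_nonneg t) (sum_range_majorant_le ht)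

theorem tsum_majorant_le {t : ℝ} (ht : 0 < t) : ∑' n, majorant t n ≤ Real.pi ^ 3 * (t ^ 2)⁻¹ :=
  Real.tsum_le_of_sum_range_le (majorant_nonneg t) (sum_range_majorant_le ht)

theorem one_le_freq (n : ℕ) : 1 ≤ freq n := by
  rw [freq]
  have := Real.pi_gt_three
  nlinarith [(Nat.cast_nonneg n : (0 : ℝ) ≤ n)]

theorem pow_mul_exp_le_majorant (t : ℝ) (n : ℕ) {k : ℕ} (hk : k ≤ 3) :
    freq n ^ k * Real.exp (-(t * freq n ^ 2) / 2) ≤ majorant t n :=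
  mul_le_mul_of_nonneg_right (pow_le_pow_right₀ (one_le_freq n) hk) (Real.exp_nonneg _)

/-! ### The kernel -/

/-- The `n`-th coefficient of the kernel: `p_t(z, ·) = ∑ₙ kernelCoef t n z ⊗ eₙ`. -/
def kernelCoef (t : ℝ) (n : ℕ) (z : 𝕏) : Fin 2 → ℂ := fun j =>
  (eigfun n (pt z) : ℂ) * expMatrix (t * freq n ^ 2) (side z) j

theorem norm_kernelCoef_le (t : ℝ) (n : ℕ) (z : 𝕏) (j : Fin 2) :
    ‖kernelCoef t n z j‖ ≤ 4 * Real.exp (-(t * freq n ^ 2) / 2) := by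
  rw [kernelCoef, norm_mul, Complex.norm_real, Real.norm_eq_abs]
  have h := mul_le_mul (abs_eigfun_le n (pt z)) (norm_expMatrix_le (t * freq n ^ 2) (side z) j)
    (norm_nonneg _) zero_le_two
  linarith

theorem norm_kernelCoef_sub_le (t : ℝ) (n : ℕ) {z z' : 𝕏} (h : side z = side z') (j : Fin 2) :
    ‖kernelCoef t n z j - kernelCoef t n z' j‖ ≤
      4 * (freq n * Real.exp (-(t * freq n ^ 2) / 2)) * |pt z - pt z'| := by
  rw [kernelCoef, kernelCoef, h, ← sub_mul, ← Complex.ofReal_sub, norm_mul, Complex.norm_real,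
    Real.norm_eq_abs]
  have h := mul_le_mul (abs_eigfun_sub_le n (pt z) (pt z'))
    (norm_expMatrix_le (t * freq n ^ 2) (side z') j) (norm_nonneg _)
    (mul_nonneg (mul_nonneg zero_le_two (freq_pos n).le) (abs_nonneg _))
  linarith

theorem norm_mode_mulVec_le (n : ℕ) {c : Fin 2 → ℂ} {C : ℝ} (hc : ∀ i, ‖c i‖ ≤ C) :
    ‖mode n (coefMatrix.mulVec c)‖ ≤ 3 * C := by
  refine (norm_mode_le _ _).trans ?_
  have e0 : coefMatrix.mulVec c 0 = c 1 := by
    simp [coefMatrix, Matrix.mulVec, dotProduct, Fin.sum_univ_two]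
  have e1 : coefMatrix.mulVec c 1 = -c 0 - c 1 := by
    simp [coefMatrix, Matrix.mulVec, dotProduct, Fin.sum_univ_two]
    ring
  rw [e0, e1]
  have h := norm_sub_le (-c 0) (c 1)
  rw [norm_neg] at h
  linarith [hc 0, hc 1]

theorem norm_smul_mode_mulVec_le (n : ℕ) {c : Fin 2 → ℂ} {C : ℝ} (hc : ∀ i, ‖c i‖ ≤ C) :
    ‖((freq n ^ 2 : ℝ) : ℂ) • mode n (coefMatrix.mulVec c)‖ ≤ 3 * (freq n ^ 2 * C) := by
  rw [norm_smul, Complex.norm_real, Real.norm_of_nonneg (sq_nonneg _)]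
  have h := mul_le_mul_of_nonneg_left (norm_mode_mulVec_le n hc) (sq_nonneg (freq n))
  linarith

theorem norm_mode_kernelCoef_le (t : ℝ) (n : ℕ) (z : 𝕏) :
    ‖mode n (kernelCoef t n z)‖ ≤ 8 * majorant t n := by
  have h := pow_mul_exp_le_majorant t n (Nat.zero_le 3)
  rw [pow_zero, one_mul] at h
  linarith [norm_mode_le n (kernelCoef t n z), norm_kernelCoef_le t n z 0,
    norm_kernelCoef_le t n z 1]

theorem norm_smul_mode_kernelCoef_le (t : ℝ) (n : ℕ) (z : 𝕏) :
    ‖((freq n ^ 2 : ℝ) : ℂ) • mode n (coefMatrix.mulVec (kernelCoef t n z))‖ ≤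
      12 * majorant t n := by
  have h := pow_mul_exp_le_majorant t n (show 2 ≤ 3 by norm_num)
  linarith [norm_smul_mode_mulVec_le n (norm_kernelCoef_le t n z)]

/-- The function `p_t(z, ·)` as an element of `L²(𝕏)`. -/
def kernelVec (t : ℝ) (z : 𝕏) : L2𝕏 := ∑' n, mode n (kernelCoef t n z)

/-- The image of `p_t(z, ·)` under the operator matrix. -/
def waveKernelVec (t : ℝ) (z : 𝕏) : L2𝕏 :=
  ∑' n, ((freq n ^ 2 : ℝ) : ℂ) • mode n (coefMatrix.mulVec (kernelCoef t n z))

/-- The kernel `p_t`. -/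
def kernel (t : ℝ) (z w : 𝕏) : ℂ := ∑' n, kernelCoef t n z (side w) * (eigfun n (pt w) : ℂ)

variable {t : ℝ}

theorem hasSum_kernelVec (ht : 0 < t) (z : 𝕏) :
    HasSum (fun n => mode n (kernelCoef t n z)) (kernelVec t z) :=
  (Summable.of_norm_bounded ((summable_majorant ht).mul_left 8)
    fun n => norm_mode_kernelCoef_le t n z).hasSum

theorem hasSum_waveKernelVec (ht : 0 < t) (z : 𝕏) :
    HasSum (fun n => ((freq n ^ 2 : ℝ) : ℂ) • mode n (coefMatrix.mulVec (kernelCoef t n z)))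
      (waveKernelVec t z) :=
  (Summable.of_norm_bounded ((summable_majorant ht).mul_left 12)
    fun n => norm_smul_mode_kernelCoef_le t n z).hasSum

theorem norm_kernel_term_le (t : ℝ) (n : ℕ) (z w : 𝕏) :
    ‖kernelCoef t n z (side w) * (eigfun n (pt w) : ℂ)‖ ≤ 8 * majorant t n := by
  have h := pow_mul_exp_le_majorant t n (Nat.zero_le 3)
  rw [pow_zero, one_mul] at h
  rw [norm_mul, Complex.norm_real, Real.norm_eq_abs]
  have h2 := mul_le_mul (norm_kernelCoef_le t n z (side w)) (abs_eigfun_le n (pt w))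
    (abs_nonneg _) (by positivity)
  linarith

theorem hasSum_kernel (ht : 0 < t) (z w : 𝕏) :
    HasSum (fun n => kernelCoef t n z (side w) * (eigfun n (pt w) : ℂ)) (kernel t z w) :=
  (Summable.of_norm_bounded ((summable_majorant ht).mul_left 8)
    fun n => norm_kernel_term_le t n z w).hasSum

/-- Since the graph of the operator matrix is closed, it can be applied to `p_t(z, ·)` term by
term. -/
theorem kernelVec_mem_graph (ht : 0 < t) (z : 𝕏) :
    (kernelVec t z, waveKernelVec t z) ∈ waveOp.graph := by
  refine isClosed_waveOp_graph.mem_of_tendsto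
    ((hasSum_kernelVec ht z).prodMk (hasSum_waveKernelVec ht z)) (Eventually.of_forall fun s => ?_)
  exact waveOp.graph.sum_mem fun n _ => mode_mem_graph n _

/-- An `L²` limit of a series agrees almost everywhere with its pointwise limit. -/
theorem ae_eq_of_hasSum {Y : Type*} [MeasurableSpace Y] {μ : Measure Y} {f : ℕ → Lp ℂ 2 μ}
    {g : Lp ℂ 2 μ} {F : ℕ → Y → ℂ} {G : Y → ℂ} (hfg : HasSum f g) (hf : ∀ n, f n =ᵐ[μ] F n)
    (hFG : ∀ y, HasSum (fun n => F n y) (G y)) : g =ᵐ[μ] G := by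
  obtain ⟨ns, hns, hlim⟩ := (tendstoInMeasure_of_tendsto_Lp
    hfg.tendsto_sum_nat).exists_seq_tendsto_ae
  have hsum : ∀ N, ∀ᵐ y ∂μ, (∑ n ∈ Finset.range N, f n : Lp ℂ 2 μ) y =
      ∑ n ∈ Finset.range N, F n y := by
    intro N
    induction N with
    | zero =>
      filter_upwards [Lp.coeFn_zero ℂ 2 μ] with y hy
      simpa using hy
    | succ N ih =>
      rw [Finset.sum_range_succ]
      filter_upwards [ih, hf N, Lp.coeFn_add (∑ n ∈ Finset.range N, f n) (f N)] with y h1 h2 h3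
      rw [h3, Pi.add_apply, h1, h2, Finset.sum_range_succ]
  filter_upwards [hlim, ae_all_iff.2 hsum] with y h1 h2
  refine tendsto_nhds_unique h1 ?_
  simp only [h2]
  exact (hFG y).tendsto_sum_nat.comp hns.tendsto_atTop

theorem coeFn_kernelVec (ht : 0 < t) (z : 𝕏) : kernelVec t z =ᵐ[leb𝕏] kernel t z :=
  ae_eq_of_hasSum (hasSum_kernelVec ht z) (fun n => coeFn_mode n _) (hasSum_kernel ht z)

theorem measurable_side : Measurable side :=
  Measurable.sumElim measurable_const measurable_const

theorem measurable_pt : Measurable pt :=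
  Measurable.sumElim measurable_subtype_coe measurable_subtype_coe

theorem measurable_eigfun_pt (n : ℕ) : Measurable fun z : 𝕏 => (eigfun n (pt z) : ℂ) :=
  Complex.measurable_ofReal.comp ((continuous_eigfun n).measurable.comp measurable_pt)

theorem measurable_side_side (M : Fin 2 → Fin 2 → ℂ) :
    Measurable fun q : 𝕏 × 𝕏 => M (side q.1) (side q.2) := by
  have hs : Measurable fun q : 𝕏 × 𝕏 => (side q.1, side q.2) :=
    (measurable_side.comp measurable_fst).prodMk (measurable_side.comp measurable_snd)
  have hf : Measurable fun i : Fin 2 × Fin 2 => M i.1 i.2 := measurable_of_finite _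
  exact hf.comp hs

theorem measurable_kernelCoef (t : ℝ) (n : ℕ) :
    Measurable fun q : 𝕏 × 𝕏 => kernelCoef t n q.1 (side q.2) * (eigfun n (pt q.2) : ℂ) :=
  (((measurable_eigfun_pt n).comp measurable_fst).mul
    (measurable_side_side (expMatrix (t * freq n ^ 2)))).mul
    ((measurable_eigfun_pt n).comp measurable_snd)

theorem measurable_kernel (ht : 0 < t) : Measurable (Function.uncurry (kernel t)) := by
  have hlim : Tendsto (fun (N : ℕ) (q : 𝕏 × 𝕏) => ∑ n ∈ Finset.range N,
      kernelCoef t n q.1 (side q.2) * (eigfun n (pt q.2) : ℂ)) atTop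
      (𝓝 (Function.uncurry (kernel t))) :=
    tendsto_pi_nhds.2 fun q => (hasSum_kernel ht q.1 q.2).tendsto_sum_nat
  refine measurable_of_tendsto_metrizable (fun N => ?_) hlim
  exact Finset.measurable_sum _ fun n _ => measurable_kernelCoef t n

/-- Both sides of `(T(t) F)(z) = ∫ p_t(z, w) F(w) dw` are the sum of the same series, in `L²` on the
left and pointwise on the right. -/
theorem isIntegralKernel_kernel {T : ℝ → L2𝕏 →L[ℂ] L2𝕏} (hT : IsSemigroupGeneratedBy waveOp T)
    (ht : 0 < t) : IsIntegralKernel (T t) (kernel t) where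
  measurable := measurable_kernel ht
  integrable F := Eventually.of_forall fun z => by
    refine ((Lp.memLp (kernelVec t z)).integrable_mul (Lp.memLp F)).congr ?_
    filter_upwards [coeFn_kernelVec ht z] with w hw
    rw [Pi.mul_apply, hw]
  apply_eq F := by
    have h1 : HasSum (fun n => mode n ((expMatrix (t * freq n ^ 2)).mulVec (coef n F)))
        (T t F) := by
      have h := (hasSum_mode_coef F).mapL (T t)
      simpa only [waveSemigroup_mode hT ht.le] using h
    have h2 : ∀ z, HasSum (fun n => (expMatrix (t * freq n ^ 2)).mulVec (coef n F) (side z) *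
        (eigfun n (pt z) : ℂ)) (∫ w, kernelVec t z w * F w ∂leb𝕏) := by
      intro z
      have h := (hasSum_kernelVec ht z).mapL (innerSL ℂ (memLp_conj F).toLp)
      simp only [innerSL_apply_apply, inner_conj_toLp, integral_mode_mul] at h
      refine h.congr_fun fun n => ?_
      simp only [kernelCoef, Matrix.mulVec, dotProduct, Fin.sum_univ_two]
      ring
    filter_upwards [ae_eq_of_hasSum h1 (fun n => coeFn_mode n _) h2] with z hz
    rw [hz]
    refine integral_congr_ae ?_
    filter_upwards [coeFn_kernelVec ht z] with w hw
    rw [hw]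

/-! ### Lipschitz estimates -/

/-- A Lipschitz estimate has to be checked only for points of the same copy, as the distance of points
of different copies is infinite. -/
theorem le_mul_sumDist {a L : ℝ} (hL : 0 < L) (z z' : 𝕏)
    (h : side z = side z' → a ≤ L * |pt z - pt z'|) :
    ENNReal.ofReal a ≤ ENNReal.ofReal L * sumDist z z' := by
  have hne : ENNReal.ofReal L ≠ 0 := (ENNReal.ofReal_pos.2 hL).ne'
  rcases z with x | x <;> rcases z' with y | y
  · refine (ENNReal.ofReal_le_ofReal (h rfl)).trans_eq ?_
    rw [ENNReal.ofReal_mul hL.le, sumDist, edist_dist]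
    rfl
  · simp [sumDist, ENNReal.mul_top hne]
  · simp [sumDist, ENNReal.mul_top hne]
  · refine (ENNReal.ofReal_le_ofReal (h rfl)).trans_eq ?_
    rw [ENNReal.ofReal_mul hL.le, sumDist, edist_dist]
    rfl

/-- Termwise comparison with the majorant bounds the distance of the sums of two series. -/
theorem norm_sub_le_of_hasSum {E : Type*} [NormedAddCommGroup E] {f g : ℕ → E} {a b : E}
    (hf : HasSum f a) (hg : HasSum g b) (ht : 0 < t) {C d : ℝ} (hd : 0 ≤ C * d)
    (h : ∀ n, ‖f n - g n‖ ≤ C * majorant t n * d) :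
    ‖a - b‖ ≤ C * (Real.pi ^ 3 * (t ^ 2)⁻¹) * d := by
  rw [← (hf.sub hg).tsum_eq]
  refine (tsum_of_norm_bounded (((summable_majorant ht).hasSum.mul_left C).mul_right d) h).trans ?_
  have := mul_le_mul_of_nonneg_left (tsum_majorant_le ht) hd
  linarith

theorem norm_kernelVec_le (ht : 0 < t) (z : 𝕏) :
    ‖kernelVec t z‖ ≤ 8 * (Real.pi ^ 3 * (t ^ 2)⁻¹) :=
  (tsum_of_norm_bounded ((summable_majorant ht).hasSum.mul_left 8)
    fun n => norm_mode_kernelCoef_le t n z).trans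
    (mul_le_mul_of_nonneg_left (tsum_majorant_le ht) (by norm_num))

theorem norm_waveKernelVec_le (ht : 0 < t) (z : 𝕏) :
    ‖waveKernelVec t z‖ ≤ 12 * (Real.pi ^ 3 * (t ^ 2)⁻¹) :=
  (tsum_of_norm_bounded ((summable_majorant ht).hasSum.mul_left 12)
    fun n => norm_smul_mode_kernelCoef_le t n z).trans
    (mul_le_mul_of_nonneg_left (tsum_majorant_le ht) (by norm_num))

theorem norm_kernel_le (ht : 0 < t) (z w : 𝕏) :
    ‖kernel t z w‖ ≤ 8 * (Real.pi ^ 3 * (t ^ 2)⁻¹) :=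
  (tsum_of_norm_bounded ((summable_majorant ht).hasSum.mul_left 8)
    fun n => norm_kernel_term_le t n z w).trans
    (mul_le_mul_of_nonneg_left (tsum_majorant_le ht) (by norm_num))

theorem norm_kernelVec_sub_le (ht : 0 < t) {z z' : 𝕏} (h : side z = side z') :
    ‖kernelVec t z - kernelVec t z'‖ ≤ 8 * (Real.pi ^ 3 * (t ^ 2)⁻¹) * |pt z - pt z'| := by
  refine norm_sub_le_of_hasSum (hasSum_kernelVec ht z) (hasSum_kernelVec ht z') ht
    (by positivity) fun n => ?_
  rw [← map_sub]
  have h1 := mul_le_mul_of_nonneg_right (pow_mul_exp_le_majorant t n (show 1 ≤ 3 by norm_num))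
    (abs_nonneg (pt z - pt z'))
  rw [pow_one] at h1
  have h2 := norm_mode_le n (kernelCoef t n z - kernelCoef t n z')
  simp only [Pi.sub_apply] at h2
  linarith [norm_kernelCoef_sub_le t n h 0, norm_kernelCoef_sub_le t n h 1]

/-- The three powers of `freq n` in the majorant come from the two derivatives in the operator
and from the Lipschitz constant of the eigenfunction. -/
theorem norm_waveKernelVec_sub_le (ht : 0 < t) {z z' : 𝕏} (h : side z = side z') :
    ‖waveKernelVec t z - waveKernelVec t z'‖ ≤
      12 * (Real.pi ^ 3 * (t ^ 2)⁻¹) * |pt z - pt z'| := by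
  refine norm_sub_le_of_hasSum (hasSum_waveKernelVec ht z) (hasSum_waveKernelVec ht z') ht
    (by positivity) fun n => ?_
  rw [← smul_sub, ← map_sub, ← Matrix.mulVec_sub]
  refine (norm_smul_mode_mulVec_le n (norm_kernelCoef_sub_le t n h)).trans_eq ?_
  rw [majorant]
  ring

theorem norm_kernel_sub_le (ht : 0 < t) {z z' w w' : 𝕏} (hz : side z = side z')
    (hw : side w = side w') :
    ‖kernel t z w - kernel t z' w'‖ ≤
      8 * (Real.pi ^ 3 * (t ^ 2)⁻¹) * (|pt z - pt z'| + |pt w - pt w'|) := by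
  refine norm_sub_le_of_hasSum (hasSum_kernel ht z w) (hasSum_kernel ht z' w') ht
    (by positivity) fun n => ?_
  have e : kernelCoef t n z (side w) * (eigfun n (pt w) : ℂ) -
      kernelCoef t n z' (side w') * (eigfun n (pt w') : ℂ) =
      (kernelCoef t n z (side w) - kernelCoef t n z' (side w)) * (eigfun n (pt w) : ℂ) +
      kernelCoef t n z' (side w) * ((eigfun n (pt w) - eigfun n (pt w') : ℝ) : ℂ) := by
    rw [← hw]
    push_cast
    ring
  have hq : 0 ≤ freq n * Real.exp (-(t * freq n ^ 2) / 2) :=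
    mul_nonneg (freq_pos n).le (Real.exp_nonneg _)
  have h1 := mul_le_mul_of_nonneg_right (pow_mul_exp_le_majorant t n (show 1 ≤ 3 by norm_num))
    (add_nonneg (abs_nonneg (pt z - pt z')) (abs_nonneg (pt w - pt w')))
  rw [pow_one] at h1
  rw [e]
  refine (norm_add_le _ _).trans ?_
  rw [norm_mul, norm_mul, Complex.norm_real, Complex.norm_real, Real.norm_eq_abs,
    Real.norm_eq_abs]
  have h2 := mul_le_mul (norm_kernelCoef_sub_le t n hz (side w)) (abs_eigfun_le n (pt w))
    (abs_nonneg _) (by positivity)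
  have h3 := mul_le_mul (norm_kernelCoef_le t n z' (side w)) (abs_eigfun_sub_le n (pt w) (pt w'))
    (abs_nonneg _) (by positivity)
  linarith

theorem isBoundedLipschitz_kernel (ht : 0 < t) :
    IsBoundedLipschitz (prodDist sumDist) (fun z : ℂ => ‖z‖)
      (fun q : 𝕏 × 𝕏 => kernel t q.1 q.2) := by
  have hL : 0 < 8 * (Real.pi ^ 3 * (t ^ 2)⁻¹) := by positivity
  refine ⟨⟨_, fun q => norm_kernel_le ht q.1 q.2⟩,
    (8 * (Real.pi ^ 3 * (t ^ 2)⁻¹)).toNNReal, fun q q' _ => ?_⟩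
  have h1 := le_mul_sumDist hL q.1 q'.1 fun h => by
    simpa using norm_kernel_sub_le ht h (rfl : side q.2 = side q.2)
  have h2 := le_mul_sumDist hL q.2 q'.2 fun h => by
    simpa using norm_kernel_sub_le ht (rfl : side q'.1 = side q'.1) h
  refine le_trans (ENNReal.ofReal_le_ofReal (norm_sub_le_norm_sub_add_norm_sub _
    (kernel t q'.1 q.2) _)) (ENNReal.ofReal_add_le.trans ?_)
  rw [prodDist, mul_add]
  exact add_le_add h1 h2

theorem isBoundedLipschitz_kernelVec (ht : 0 < t) {P : 𝕏 → waveOp.domain}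
    (hP : ∀ z, (P z : L2𝕏) = kernelVec t z) (hP' : ∀ z, waveOp (P z) = waveKernelVec t z) :
    IsBoundedLipschitz sumDist (graphNorm waveOp) P := by
  have hL : 0 < 20 * (Real.pi ^ 3 * (t ^ 2)⁻¹) := by positivity
  refine ⟨⟨20 * (Real.pi ^ 3 * (t ^ 2)⁻¹), fun z => ?_⟩,
    (20 * (Real.pi ^ 3 * (t ^ 2)⁻¹)).toNNReal, fun z z' _ => le_mul_sumDist hL z z' fun h => ?_⟩
  · rw [graphNorm, hP, hP']
    linarith [norm_kernelVec_le ht z, norm_waveKernelVec_le ht z]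
  · rw [graphNorm, LinearPMap.map_sub, hP', hP', Submodule.coe_sub, hP, hP]
    linarith [norm_kernelVec_sub_le ht h, norm_waveKernelVec_sub_le ht h]

end DampedWave

end

theorem mainTheorem10 :
    (∃ T : ℝ → DampedWave.L2𝕏 →L[ℂ] DampedWave.L2𝕏,
      DampedWave.IsSemigroupGeneratedBy DampedWave.waveOp T) ∧
    ∀ T : ℝ → DampedWave.L2𝕏 →L[ℂ] DampedWave.L2𝕏,
      DampedWave.IsSemigroupGeneratedBy DampedWave.waveOp T →
      ∃ (p : ℝ → DampedWave.𝕏 → DampedWave.𝕏 → ℂ)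
        (P : ℝ → DampedWave.𝕏 → DampedWave.waveOp.domain),
        (∀ t : ℝ, 0 < t →
          DampedWave.IsIntegralKernel (T t) (p t) ∧
          DampedWave.IsBoundedLipschitz (DampedWave.prodDist DampedWave.sumDist)
            (fun z : ℂ => ‖z‖) (fun q : DampedWave.𝕏 × DampedWave.𝕏 => p t q.1 q.2) ∧
          (∀ x : DampedWave.𝕏,
            ∀ᵐ y ∂DampedWave.leb𝕏, (P t x : DampedWave.L2𝕏) y = p t x y) ∧
          DampedWave.IsBoundedLipschitz DampedWave.sumDist
            (DampedWave.graphNorm DampedWave.waveOp) (P t)) ∧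
        ∃ C₁ C₂ : ℝ, 0 < C₁ ∧ 0 < C₂ ∧
          ∀ t : ℝ, 0 < t → ∀ x x' : DampedWave.𝕏,
            ENNReal.ofReal ‖DampedWave.waveOp (P t x) - DampedWave.waveOp (P t x')‖ ≤
              ENNReal.ofReal (C₁ * t⁻¹ + C₂ * (t ^ 2)⁻¹) * DampedWave.sumDist x x' := by
  refine ⟨DampedWave.exists_waveSemigroup, fun T hT => ?_⟩
  have hex : ∀ (t : ℝ) (z : DampedWave.𝕏), ∃ u : DampedWave.waveOp.domain, 0 < t →
      (u : DampedWave.L2𝕏) = DampedWave.kernelVec t z ∧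
      DampedWave.waveOp u = DampedWave.waveKernelVec t z := by
    intro t z
    by_cases ht : 0 < t
    · obtain ⟨u, hu⟩ := (LinearPMap.mem_graph_iff _).1 (DampedWave.kernelVec_mem_graph ht z)
      exact ⟨u, fun _ => hu⟩
    · exact ⟨0, fun h => absurd h ht⟩
  choose P hP using hex
  refine ⟨DampedWave.kernel, P, fun t ht => ⟨DampedWave.isIntegralKernel_kernel hT ht,
    DampedWave.isBoundedLipschitz_kernel ht, fun x => ?_,
    DampedWave.isBoundedLipschitz_kernelVec ht (fun z => (hP t z ht).1) fun z => (hP t z ht).2⟩,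
    1, 12 * Real.pi ^ 3, one_pos, by positivity, fun t ht x x' => ?_⟩
  · rw [(hP t x ht).1]
    exact DampedWave.coeFn_kernelVec ht x
  · rw [(hP t x ht).2, (hP t x' ht).2]
    refine DampedWave.le_mul_sumDist (by positivity) x x' fun h => ?_
    refine (DampedWave.norm_waveKernelVec_sub_le ht h).trans
      (mul_le_mul_of_nonneg_right ?_ (abs_nonneg _))
    linarith [inv_pos.2 ht]
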